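/- Let $\mathbb E=\mathbb R$ or $\mathbb E=\mathbb C$, and let $k>n\ge 1$ be integers. Let $$\mathcal G^{\mathbb E}_{k,n}=\{\tfrac kn P : P\in M_k(\mathbb E)\text{ a self-adjoint projection of rank } n,\ P_{ii}=\tfrac nk\ (1\le i\le k)\}.$$ For $A\subseteq\{1,\dots,k\}$ let $Q_A\in M_k(\mathbb E)$ be the diagonal projection onto the span of the standard basis vectors indexed by $A$. For $T\in M_k(\mathbb E)$ let $\sigma_T$ be the set of all minimal nonempty subsets $A$ of $\{1,\dots,k\}$ with $Q_AT=TQ_A$; it is a partition of $\{1,\dots,k\}$. For a partition $\sigma$ of $\{1,\dots,k\}$ let $N^{\mathbb E}_{k,n}(\sigma)=\{R\in\mathcal G^{\mathbb E}_{k,n}:\sigma_R=\sigma\}$, and let $N^{\mathbb E}_{k,n}=N^{\mathbb E}_{k,n}(\{\{1,\dots,k\}\})$. Let $d=\gcd(k,n)$, $k'=k/d$, $n'=n/d$, and let $\mathcal P(k,k')$ be the set of all partitions of $\{1,\dots,k\}$ into (nonempty) subsets whose cardinalities are multiples of $k'$. Then: (i) $N^{\mathbb E}_{k,n}$ is a nonempty,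 regular (i.e. embedded) real-analytic submanifold of $M_k(\mathbb E)$, of dimension $(k-n-1)(n-1)$ if $\mathbb E=\mathbb R$ and of dimension $2n(k-n)-k+1$ if $\mathbb E=\mathbb C$. (ii) $\mathcal G^{\mathbb E}_{k,n}=\bigcup_{\sigma\in\mathcal P(k,k')}N^{\mathbb E}_{k,n}(\sigma)$, and the sets $N^{\mathbb E}_{k,n}(\sigma)$, $\sigma\in\mathcal P(k,k')$, are pairwise disjoint. (iii) If $\sigma=\{A_1,\dots,A_\ell\}\in\mathcal P(k,k')$ with $|A_i|=m_ik'$, then $N^{\mathbb E}_{k,n}(\sigma)$ is a nonempty, regular, real-analytic submanifold of $M_k(\mathbb E)$ and is real-analytically diffeomorphic to the Cartesian product $\prod_{i=1}^{\ell}N^{\mathbb E}_{m_ik',\,m_in'}$. -/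

import Mathlib

/-! The space of `k × k` matrices is given the entrywise sup norm.  All norms on this
finite-dimensional real vector space are equivalent, so the choice affects neither the topology
nor real analyticity. -/
attribute [local instance] Matrix.normedAddCommGroup Matrix.normedSpace

namespace TightFrame

/-- `S` is a regular (embedded) real-analytic submanifold of dimension `d` of the real normed
space `V`: around each of its points there is a real-analytic chart of `V` that carries `S` to a
`d`-dimensional linear subspace. -/
def IsAnalyticSubmanifold {V : Type*} [NormedAddCommGroup V] [NormedSpace ℝ V]
    (S : Set V) (d : ℕ) : Prop :=
  ∀ p ∈ S, ∃ (Φ : OpenPartialHomeomorph V V) (L : Submodule ℝ V),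
    p ∈ Φ.source ∧
    AnalyticOnNhd ℝ Φ Φ.source ∧
    AnalyticOnNhd ℝ Φ.symm Φ.target ∧
    Module.Finite ℝ L ∧ Module.finrank ℝ L = d ∧
    ∀ x ∈ Φ.source, (x ∈ S ↔ Φ x ∈ L)

/-- `S ⊆ V` and `T ⊆ W` are real-analytically diffeomorphic: there are mutually inverse bijections
between them, both real analytic.  (`AnalyticOn ℝ f S` says that near each point of `S` the
restriction of `f` to `S` extends to a real-analytic map on an open set of the ambient space; on
regular analytic submanifolds this is analyticity as a map of manifolds.) -/
def AnalyticallyDiffeomorphic {V W : Type*} [NormedAddCommGroup V] [NormedSpace ℝ V]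
    [NormedAddCommGroup W] [NormedSpace ℝ W] (S : Set V) (T : Set W) : Prop :=
  ∃ (f : V → W) (g : W → V),
    Set.MapsTo f S T ∧ Set.MapsTo g T S ∧ Set.InvOn g f S T ∧
    AnalyticOn ℝ f S ∧ AnalyticOn ℝ g T

/-- The set of all matrices `(k / n) • P`, where `P` is a (self-adjoint) projection in
`M_k(𝕜)` of rank `n` all of whose diagonal entries are `n / k`. -/
def G (𝕜 : Type*) [RCLike 𝕜] (k n : ℕ) : Set (Matrix (Fin k) (Fin k) 𝕜) :=
  {R | ∃ P : Matrix (Fin k) (Fin k) 𝕜,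
    IsStarProjection P ∧ P.rank = n ∧ (∀ i, P i i = (n : 𝕜) / (k : 𝕜)) ∧
    R = ((k : 𝕜) / (n : 𝕜)) • P}

/-- The coordinate projection of `𝕜 ^ k` onto the span of the standard basis vectors indexed
by `A`. -/
def coordProj (𝕜 : Type*) [RCLike 𝕜] {k : ℕ} (A : Finset (Fin k)) :
    Matrix (Fin k) (Fin k) 𝕜 :=
  Matrix.diagonal fun i => if i ∈ A then 1 else 0

/-- The commutation partition `σ_T`: the set of all minimal nonempty subsets `A` of the index set
such that the coordinate projection of `A` commutes with `T`. -/
def commPartition {𝕜 : Type*} [RCLike 𝕜] {k : ℕ} (T : Matrix (Fin k) (Fin k) 𝕜) :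
    Set (Finset (Fin k)) :=
  {A | Minimal (fun B : Finset (Fin k) =>
    B.Nonempty ∧ coordProj 𝕜 B * T = T * coordProj 𝕜 B) A}

/-- The stratum `N_{k,n}(σ)` of all `R ∈ G_{k,n}` with `σ_R = σ`. -/
def stratum (𝕜 : Type*) [RCLike 𝕜] (k n : ℕ) (σ : Set (Finset (Fin k))) :
    Set (Matrix (Fin k) (Fin k) 𝕜) :=
  {R | R ∈ G 𝕜 k n ∧ commPartition R = σ}

/-- `N_{k,n}`, the stratum of the trivial partition of the index set into one block. -/
def N (𝕜 : Type*) [RCLike 𝕜] (k n : ℕ) : Set (Matrix (Fin k) (Fin k) 𝕜) :=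
  stratum 𝕜 k n {Finset.univ}

/-- The partitions of the index set into (nonempty) blocks whose sizes are multiples of `q`. -/
def partitionsByMultiples (k q : ℕ) : Set (Finpartition (Finset.univ : Finset (Fin k))) :=
  {σ | ∀ A ∈ σ.parts, q ∣ A.card}

end TightFrame

/-! Write `R = (k/n) P`. The matrix `Q_A` commutes with `R` exactly when no nonzero entry of `R`
links `A` to its complement, so `σ_R` is the set of connected components of the graph of nonzero
entries. On a component `A`, the compression `Q_A P` is idempotent, and its trace `|A| n / k` is its
rank. Hence `k'` divides `|A|`, which gives the decomposition (ii) (`G_eq_iUnion_stratum`). A real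
projection onto `n` consecutive frequencies is connected, so `N` is nonempty (`N_nonempty`).

For smoothness, fix `p` in a stratum, with projection `P`. Nearby block diagonal Hermitian
projections are cut out by the two diagonal corners of `c x² - x` relative to `P`, with `c = n/k`;
the off-diagonal corners then vanish automatically (`eventually_isProj`). The diagonal conditions
are independent after one index per block is dropped: on tangent vectors `PΔ(1-P) + (1-P)ΔP` with
`Δ` real diagonal, the diagonal map is a graph Laplacian with weights `|P i j|²`, and connectedness
of the blocks makes it surjective (`exists_tangent_reDiag_eq`). The dropped conditions return
because block traces of projections are integers, hence locally constant (`eventually_sum_diag_eq`).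
All equations are quadratic, and `isAnalyticSubmanifold_of_quadratic` turns them into charts.

The tangent space of the projections is identified with the range of `X ↦ P X (1-P)` on block
diagonal matrices. This map is idempotent, so its rank is its trace, `c(1-c)` times the number of
index pairs lying in a common block. Subtracting the diagonal conditions gives the dimensions in
(i).

For (iii), cutting a matrix into diagonal blocks is linear with linear inverse, and every defining
condition splits over the blocks because `n/k = n'/k'` (`assemble_mem_blockStratum_iff`). -/

namespace TightFrame

open Filter Topology

/-! ### Charts for zero sets of quadratic maps -/

/-- A linear map admits a linear section over its range. -/
theorem exists_section_on_range {K V W : Type*} [Field K] [AddCommGroup V] [Module K V]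
    [AddCommGroup W] [Module K W] (D : V →ₗ[K] W) :
    ∃ r : W →ₗ[K] V, ∀ y ∈ LinearMap.range D, D (r y) = y := by
  obtain ⟨s, hs⟩ := D.rangeRestrict.exists_rightInverse_of_surjective D.range_rangeRestrict
  obtain ⟨r, hr⟩ := LinearMap.exists_extend s
  refine ⟨r, fun y hy => ?_⟩
  have h1 : r y = s ⟨y, hy⟩ := by rw [← hr]; rfl
  have h2 := congrArg Subtype.val (LinearMap.congr_fun hs ⟨y, hy⟩)
  rw [h1]
  simpa using h2

/-- A subset of a finite-dimensional space that near each of its points is the zero set of a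
quadratic map, with values in the range of its differential at that point, is a regular analytic
submanifold. -/
theorem isAnalyticSubmanifold_of_quadratic {V W : Type*} [NormedAddCommGroup V] [NormedSpace ℝ V]
    [FiniteDimensional ℝ V] [AddCommGroup W] [Module ℝ W] (S : Set V) (d : ℕ)
    (h : ∀ p ∈ S, ∃ (D : V →ₗ[ℝ] W) (B : V →ₗ[ℝ] V →ₗ[ℝ] W),
      (∀ y, B y y ∈ LinearMap.range D) ∧
      (∀ᶠ x in 𝓝 p, x ∈ S ↔ D (x - p) + B (x - p) (x - p) = 0) ∧
      Module.finrank ℝ (LinearMap.ker D) = d) :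
    IsAnalyticSubmanifold S d := by
  intro p hp
  obtain ⟨D, B, hB, hS, hd⟩ := h p hp
  obtain ⟨r, hr⟩ := exists_section_on_range D
  -- With `r` a section of `D` over its range, `D (φ x) = D (x - p) + B (x - p) (x - p)`, so `S` is
  -- locally the preimage of `ker D` under `φ`. The derivative of `φ` at `p` is the identity, so the
  -- inverse function theorem makes `φ` a chart.
  let C : V →L[ℝ] V →L[ℝ] V := (B.compr₂ r).toContinuousBilinearMap
  let φ : V → V := fun x => (x - p) + C (x - p) (x - p)
  have hana : ∀ x, AnalyticAt ℝ φ x := by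
    intro x
    have h1 : AnalyticAt ℝ (fun x : V => x - p) x := analyticAt_id.sub analyticAt_const
    exact h1.add ((C.analyticAt_bilinear (x - p, x - p)).comp (f := fun x => (x - p, x - p))
      (h1.prod h1))
  have hder : HasFDerivAt φ ((ContinuousLinearEquiv.refl ℝ V : V ≃L[ℝ] V) : V →L[ℝ] V) p := by
    have h1 : HasFDerivAt (fun x : V => x - p) (ContinuousLinearMap.id ℝ V) p :=
      (hasFDerivAt_id p).sub_const p
    have h2 := h1.add (C.hasFDerivAt_of_bilinear h1 h1)
    refine h2.congr_fderiv ?_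
    ext v
    simp
  have hcd : ContDiffAt ℝ ⊤ φ p := (hana p).contDiffAt
  have hstrict := hcd.hasStrictFDerivAt' hder (by simp)
  let Ψ := hstrict.toOpenPartialHomeomorph φ
  have hpΨ : p ∈ Ψ.source := hstrict.mem_toOpenPartialHomeomorph_source
  have hsymm : AnalyticAt ℝ Ψ.symm (Ψ p) :=
    Ψ.analyticAt_symm' hpΨ (hana p) hder.fderiv
  obtain ⟨U, hUsub, hUo, hpU⟩ := eventually_nhds_iff.1 hS
  obtain ⟨T, hTsub, hTo, hpT⟩ := eventually_nhds_iff.1 hsymm.eventually_analyticAt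
  have hO : IsOpen (Ψ.source ∩ Ψ ⁻¹' T) := Ψ.isOpen_inter_preimage hTo
  refine ⟨Ψ.restrOpen (U ∩ (Ψ.source ∩ Ψ ⁻¹' T)) (hUo.inter hO), LinearMap.ker D, ?_, ?_, ?_,
    inferInstance, hd, ?_⟩
  · exact ⟨hpΨ, hpU, hpΨ, hpT⟩
  · intro x _
    exact hana x
  · intro y hy
    have hy' : y ∈ Ψ.target ∩ Ψ.symm ⁻¹' (U ∩ (Ψ.source ∩ Ψ ⁻¹' T)) := hy
    have := hTsub _ hy'.2.2.2
    rwa [Ψ.right_inv hy'.1] at this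
  · intro x hx
    have hx' : x ∈ Ψ.source ∩ (U ∩ (Ψ.source ∩ Ψ ⁻¹' T)) := hx
    rw [hUsub x hx'.2.1]
    change _ ↔ D ((x - p) + r (B (x - p) (x - p))) = 0
    rw [map_add, hr _ (hB _)]

/-- A bilinear operator with small left argument has no nonzero fixed vectors. -/
theorem eventually_eq_zero_of_fixed {V : Type*} [NormedAddCommGroup V] [NormedSpace ℝ V]
    [FiniteDimensional ℝ V] (B : V →ₗ[ℝ] V →ₗ[ℝ] V) (p : V) :
    ∀ᶠ x in 𝓝 p, ∀ a, a = B (x - p) a → a = 0 := by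
  let C : V →L[ℝ] V →L[ℝ] V := B.toContinuousBilinearMap
  have hc : Continuous fun x => ‖C (x - p)‖ := by fun_prop
  have h0 : ‖C (p - p)‖ < 1 := by simp
  filter_upwards [hc.continuousAt.eventually_lt continuousAt_const h0] with x hx a ha
  by_contra hne
  have h1 : ‖a‖ ≤ ‖C (x - p)‖ * ‖a‖ := by
    conv_lhs => rw [ha]
    exact (C (x - p)).le_opNorm a
  have h2 : 0 < ‖a‖ := norm_pos_iff.2 hne
  nlinarith

end TightFrame

/-! ### The commutation partition and the decomposition into strata -/

namespace TightFrame

/-- No nonzero entry of `T` links `A` to its complement. -/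
def Inv {𝕜 : Type*} [Zero 𝕜] {k : ℕ} (T : Matrix (Fin k) (Fin k) 𝕜) (A : Finset (Fin k)) : Prop :=
  ∀ i j, T i j ≠ 0 → (i ∈ A ↔ j ∈ A)

/-- The blocks of the labelling `b` are the connected components of the graph of nonzero entries
of `T`. -/
def BlockConn {𝕜 β : Type*} [Zero 𝕜] {k : ℕ} (b : Fin k → β) (T : Matrix (Fin k) (Fin k) 𝕜) :
    Prop :=
  (∀ i j, T i j ≠ 0 → b i = b j) ∧
    ∀ A : Finset (Fin k), Inv T A → ∀ i j, b i = b j → i ∈ A → j ∈ A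

section
variable {𝕜 : Type*} [RCLike 𝕜] {k n : ℕ}

theorem coordProj_comm_iff (T : Matrix (Fin k) (Fin k) 𝕜) (A : Finset (Fin k)) :
    coordProj 𝕜 A * T = T * coordProj 𝕜 A ↔ Inv T A := by
  rw [← Matrix.ext_iff]
  simp only [coordProj, Matrix.diagonal_mul, Matrix.mul_diagonal, Inv]
  refine forall_congr' fun i => forall_congr' fun j => ?_
  by_cases hi : i ∈ A <;> by_cases hj : j ∈ A <;> simp [hi, hj, eq_comm]

theorem mem_commPartition_iff (T : Matrix (Fin k) (Fin k) 𝕜) (A : Finset (Fin k)) :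
    A ∈ commPartition T ↔ (A.Nonempty ∧ Inv T A) ∧
      ∀ B : Finset (Fin k), B.Nonempty → Inv T B → B ⊆ A → A ⊆ B := by
  simp only [commPartition, Set.mem_ofPred_eq, Minimal, coordProj_comm_iff, and_imp]

theorem Inv.inter {T : Matrix (Fin k) (Fin k) 𝕜} {A B : Finset (Fin k)} (hA : Inv T A)
    (hB : Inv T B) : Inv T (A ∩ B) := by
  intro i j h
  rw [Finset.mem_inter, Finset.mem_inter, hA i j h, hB i j h]

theorem inv_smul_iff {c : 𝕜} (hc : c ≠ 0) (T : Matrix (Fin k) (Fin k) 𝕜) (A : Finset (Fin k)) :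
    Inv (c • T) A ↔ Inv T A := by
  simp [Inv, hc]

/-- Invariant sets are closed under intersection, so a minimal one lies inside every invariant set
it meets. This replaces minimality by a connectivity condition on a labelling, which is easier to
perturb and to split into blocks. -/
theorem commPartition_eq_parts_iff (T : Matrix (Fin k) (Fin k) 𝕜)
    (σ : Finpartition (Finset.univ : Finset (Fin k))) :
    commPartition T = ↑σ.parts ↔ BlockConn σ.part T := by
  have hself : ∀ i, i ∈ σ.part i := fun i => by simp
  have hpart : ∀ i, σ.part i ∈ σ.parts := fun i => by simp
  have hmem : ∀ i j, i ∈ σ.part j ↔ σ.part i = σ.part j := fun i j =>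
    σ.mem_part_iff_part_eq_part (Finset.mem_univ i) (Finset.mem_univ j)
  constructor
  · intro h
    have hcp : ∀ i, σ.part i ∈ commPartition T := fun i => by rw [h]; exact hpart i
    refine ⟨fun i j hij => ?_, fun A hA i j hij hiA => ?_⟩
    · have h1 := ((mem_commPartition_iff T _).1 (hcp j)).1.2 i j hij
      exact (hmem i j).1 (h1.2 (hself j))
    · have h1 := (mem_commPartition_iff T _).1 (hcp i)
      have h2 := h1.2 (A ∩ σ.part i) ⟨i, Finset.mem_inter.2 ⟨hiA, hself i⟩⟩ (hA.inter h1.1.2)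
        Finset.inter_subset_right
      exact (Finset.mem_inter.1 (h2 ((hmem j i).2 hij.symm))).1
  · rintro ⟨h1, h2⟩
    have hinv : ∀ i, Inv T (σ.part i) := fun i j l hjl => by
      rw [hmem, hmem, h1 j l hjl]
    ext A
    rw [mem_commPartition_iff]
    constructor
    · rintro ⟨⟨⟨i, hi⟩, hA⟩, hmin⟩
      have hsub : σ.part i ⊆ A := fun j hj => h2 A hA i j ((hmem j i).1 hj).symm hi
      rw [← hsub.antisymm (hmin _ ⟨i, hself i⟩ (hinv i) hsub)]
      exact hpart i
    · intro hA
      obtain ⟨i, hi⟩ := σ.nonempty_of_mem_parts hA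
      obtain rfl := σ.part_eq_of_mem hA hi
      refine ⟨⟨⟨i, hi⟩, hinv i⟩, ?_⟩
      rintro B ⟨l, hl⟩ hB hBsub j hj
      exact h2 B hB l j (((hmem l i).1 (hBsub hl)).trans ((hmem j i).1 hj).symm) hl

theorem commPartition_eq_univ_iff (hk : 0 < k) (T : Matrix (Fin k) (Fin k) 𝕜) :
    commPartition T = {Finset.univ} ↔ BlockConn (fun _ => ()) T := by
  have hne : (Finset.univ : Finset (Fin k)) ≠ ⊥ :=
    Finset.nonempty_iff_ne_empty.1 ⟨⟨0, hk⟩, Finset.mem_univ _⟩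
  have h := commPartition_eq_parts_iff T (Finpartition.indiscrete hne)
  have hp : ∀ i, (Finpartition.indiscrete hne).part i = Finset.univ := fun i =>
    Finpartition.part_eq_of_mem _ (by simp) (Finset.mem_univ i)
  simp only [Finpartition.indiscrete_parts, Finset.coe_singleton] at h
  rw [h]
  simp only [BlockConn, hp, implies_true]

theorem exists_finpartition_commPartition (T : Matrix (Fin k) (Fin k) 𝕜) :
    ∃ σ : Finpartition (Finset.univ : Finset (Fin k)), commPartition T = ↑σ.parts := by
  classical
  -- Two indices are equivalent when no invariant set separates them; the classes are the connected
  -- components.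
  let s : Setoid (Fin k) :=
    { r := fun i j => ∀ A, Inv T A → (i ∈ A ↔ j ∈ A)
      iseqv := ⟨fun _ _ _ => Iff.rfl, fun h A hA => (h A hA).symm,
        fun h h' A hA => (h A hA).trans (h' A hA)⟩ }
  refine ⟨Finpartition.ofSetoid s, ?_⟩
  have hs : ∀ i j, (Finpartition.ofSetoid s).part i = (Finpartition.ofSetoid s).part j ↔
      ∀ A, Inv T A → (i ∈ A ↔ j ∈ A) := fun i j => by
    rw [eq_comm, ← Finpartition.mem_part_iff_part_eq_part _ (Finset.mem_univ j)
      (Finset.mem_univ i), Finpartition.mem_part_ofSetoid_iff_rel]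
    rfl
  rw [commPartition_eq_parts_iff]
  exact ⟨fun i j hij => (hs i j).2 fun A hA => hA i j hij,
    fun A hA i j hij hi => ((hs i j).1 hij A hA).1 hi⟩

theorem trace_eq_rank_of_isIdempotentElem {P : Matrix (Fin k) (Fin k) 𝕜} (hP : P * P = P) :
    P.trace = (P.rank : 𝕜) := by
  have h1 : IsIdempotentElem (Matrix.toLin' P) := by
    rw [IsIdempotentElem, Module.End.mul_eq_comp, ← Matrix.toLin'_mul, hP]
  have h2 := (LinearMap.isProj_range_iff_isIdempotentElem _).2 h1
  rw [← Matrix.trace_toLin'_eq, h2.trace]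
  rfl

/-- The trace of a projection over an invariant set of indices is a natural number. -/
theorem exists_nat_sum_diag {P : Matrix (Fin k) (Fin k) 𝕜} (hP : P * P = P)
    {A : Finset (Fin k)} (hA : Inv P A) : ∃ r : ℕ, ∑ i ∈ A, P i i = (r : 𝕜) := by
  have hc := (coordProj_comm_iff P A).2 hA
  have hAA : coordProj 𝕜 A * coordProj 𝕜 A = coordProj 𝕜 A := by
    simp [coordProj, Matrix.diagonal_mul_diagonal]
  have hid : (coordProj 𝕜 A * P) * (coordProj 𝕜 A * P) = coordProj 𝕜 A * P := by
    calc _ = (coordProj 𝕜 A * (P * coordProj 𝕜 A)) * P := by simp only [Matrix.mul_assoc]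
      _ = (coordProj 𝕜 A * coordProj 𝕜 A) * (P * P) := by
        rw [← hc]; simp only [Matrix.mul_assoc]
      _ = _ := by rw [hAA, hP]
  refine ⟨_, Eq.trans ?_ (trace_eq_rank_of_isIdempotentElem hid)⟩
  simp [Matrix.trace, coordProj, Matrix.diagonal_mul, Finset.sum_ite_mem]

/-- The rank condition is redundant: the rank of an idempotent is its trace, which the diagonal
entries already determine. -/
theorem mem_G_iff (hn : 0 < n) (hk : 0 < k) (R : Matrix (Fin k) (Fin k) 𝕜) :
    R ∈ G 𝕜 k n ↔ R.conjTranspose = R ∧ ((n : 𝕜) / k) • (R * R) = R ∧ ∀ i, R i i = 1 := by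
  have hn' : (n : 𝕜) ≠ 0 := by exact_mod_cast hn.ne'
  have hk' : (k : 𝕜) ≠ 0 := by exact_mod_cast hk.ne'
  have hc : (n : 𝕜) / k ≠ 0 := div_ne_zero hn' hk'
  have hcc : ((k : 𝕜) / n) * (n / k) = 1 := by field_simp
  have hstar : ∀ a b : ℕ, star ((a : 𝕜) / b) = (a : 𝕜) / b := fun a b => by simp
  constructor
  · rintro ⟨P, hP, hr, hd, rfl⟩
    have h1 : P.conjTranspose = P := hP.isSelfAdjoint
    have h2 : P * P = P := hP.isIdempotentElem
    refine ⟨?_, ?_, fun i => ?_⟩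
    · rw [Matrix.conjTranspose_smul, hstar, h1]
    · rw [Matrix.smul_mul, Matrix.mul_smul, h2, smul_smul, mul_comm ((n : 𝕜) / k), hcc, one_smul]
    · rw [Matrix.smul_apply, hd, smul_eq_mul, hcc]
  · rintro ⟨h1, h2, h3⟩
    have hid : (((n : 𝕜) / k) • R) * (((n : 𝕜) / k) • R) = ((n : 𝕜) / k) • R := by
      rw [Matrix.smul_mul, Matrix.mul_smul, h2]
    refine ⟨((n : 𝕜) / k) • R, ⟨hid, ?_⟩, ?_, fun i => ?_, ?_⟩
    · change (((n : 𝕜) / k) • R).conjTranspose = _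
      rw [Matrix.conjTranspose_smul, hstar, h1]
    · have := trace_eq_rank_of_isIdempotentElem hid
      have h4 : (((n : 𝕜) / k) • R).trace = n := by
        simp [Matrix.trace, h3]
        field_simp
      rw [h4] at this
      exact_mod_cast this.symm
    · simp [h3]
    · rw [smul_smul, hcc, one_smul]

/-- The witness `r` is the rank of the idempotent `Q_A P`, whose trace is `|A| n / k`. -/
theorem exists_nat_mul_card {R : Matrix (Fin k) (Fin k) 𝕜} (hn : 0 < n) (hk : 0 < k)
    (hR : R ∈ G 𝕜 k n) {A : Finset (Fin k)} (hA : Inv R A) : ∃ r : ℕ, A.card * n = r * k := by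
  obtain ⟨h1, h2, h3⟩ := (mem_G_iff hn hk R).1 hR
  have hn' : (n : 𝕜) ≠ 0 := by exact_mod_cast hn.ne'
  have hk' : (k : 𝕜) ≠ 0 := by exact_mod_cast hk.ne'
  have hid : (((n : 𝕜) / k) • R) * (((n : 𝕜) / k) • R) = ((n : 𝕜) / k) • R := by
    rw [Matrix.smul_mul, Matrix.mul_smul, h2]
  obtain ⟨r, hr⟩ := exists_nat_sum_diag hid ((inv_smul_iff (div_ne_zero hn' hk') R A).2 hA)
  refine ⟨r, ?_⟩
  simp only [Matrix.smul_apply, h3, Finset.sum_const, smul_eq_mul, mul_one, nsmul_eq_mul] at hr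
  rw [← mul_div_assoc, div_eq_iff hk'] at hr
  exact_mod_cast hr

theorem G_eq_iUnion_stratum (hn : 0 < n) (hk : 0 < k) :
    G 𝕜 k n = ⋃ σ ∈ partitionsByMultiples k (k / Nat.gcd k n), stratum 𝕜 k n ↑σ.parts := by
  ext R
  simp only [Set.mem_iUnion, exists_prop]
  constructor
  · intro hR
    obtain ⟨σ, hσ⟩ := exists_finpartition_commPartition R
    refine ⟨σ, fun A hA => ?_, hR, hσ⟩
    have hA' : A ∈ commPartition R := by rw [hσ]; exact hA
    obtain ⟨r, hr⟩ := exists_nat_mul_card hn hk hR ((mem_commPartition_iff R A).1 hA').1.2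
    have hg : 0 < Nat.gcd k n := Nat.gcd_pos_of_pos_left n hk
    have hcop : Nat.Coprime (k / Nat.gcd k n) (n / Nat.gcd k n) :=
      Nat.coprime_div_gcd_div_gcd hg
    refine hcop.dvd_of_dvd_mul_right ⟨r, ?_⟩
    apply Nat.eq_of_mul_eq_mul_right hg
    rw [mul_assoc, Nat.div_mul_cancel (Nat.gcd_dvd_right k n), hr, mul_right_comm,
      Nat.div_mul_cancel (Nat.gcd_dvd_left k n), mul_comm]
  · rintro ⟨σ, -, hR⟩
    exact hR.1

theorem pairwiseDisjoint_stratum (𝕜 : Type*) [RCLike 𝕜] (k n : ℕ)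
    (s : Set (Finpartition (Finset.univ : Finset (Fin k)))) :
    s.PairwiseDisjoint (fun σ => stratum 𝕜 k n ↑σ.parts) := by
  intro σ _ τ _ hne
  refine Set.disjoint_left.2 fun R h1 h2 => hne (Finpartition.ext ?_)
  exact Finset.coe_injective (h1.2.symm.trans h2.2)

end

end TightFrame

/-! ### Nonemptiness: a connected harmonic projection -/

namespace TightFrame

/-- The character `x ↦ exp (π i x / k)` of the integers. -/
noncomputable def halfChar (k : ℕ) (x : ℤ) : ℂ := Complex.exp (Real.pi * Complex.I * x / k)

theorem halfChar_add (k : ℕ) (x y : ℤ) : halfChar k (x + y) = halfChar k x * halfChar k y := by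
  rw [halfChar, halfChar, halfChar, ← Complex.exp_add]
  congr 1
  push_cast
  ring

theorem halfChar_nat_mul (k m : ℕ) (x : ℤ) : halfChar k (m * x) = halfChar k x ^ m := by
  rw [halfChar, halfChar, ← Complex.exp_nat_mul]
  congr 1
  push_cast
  ring

theorem halfChar_zero (k : ℕ) : halfChar k 0 = 1 := by simp [halfChar]

theorem star_halfChar (k : ℕ) (x : ℤ) : star (halfChar k x) = halfChar k (-x) := by
  rw [halfChar, halfChar, Complex.star_def, ← Complex.exp_conj]
  congr 1
  simp

theorem halfChar_two_mul_eq_one_iff {k : ℕ} (hk : 0 < k) (x : ℤ) :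
    halfChar k (2 * x) = 1 ↔ (k : ℤ) ∣ x := by
  have hk' : (k : ℂ) ≠ 0 := by exact_mod_cast hk.ne'
  have hpi : (Real.pi : ℂ) ≠ 0 := by exact_mod_cast Real.pi_ne_zero
  rw [halfChar, Complex.exp_eq_one_iff]
  refine exists_congr fun m => ?_
  rw [div_eq_iff hk']
  have h2 : (2 * Real.pi * Complex.I : ℂ) ≠ 0 := by simp [hpi]
  constructor
  · intro h
    have : (2 * Real.pi * Complex.I : ℂ) * x = (2 * Real.pi * Complex.I) * ((k : ℂ) * m) := by
      push_cast at h
      linear_combination h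
    exact_mod_cast mul_left_cancel₀ h2 this
  · rintro rfl
    push_cast
    ring

/-- The rank `n` projection onto the span of `n` consecutive, symmetrically placed
(half-)integer frequencies. -/
noncomputable def harmonicProj (k n : ℕ) (x : ℤ) : ℂ :=
  (k : ℂ)⁻¹ * ∑ a ∈ Finset.range n, halfChar k ((2 * a + 1 - n) * x)

/-- The substitution `a ↦ n - 1 - a` negates every frequency `2a + 1 - n`. Together with conjugation
this makes the kernel real, so one matrix serves both scalar fields. -/
theorem harmonicProj_neg (k n : ℕ) (x : ℤ) : harmonicProj k n (-x) = harmonicProj k n x := by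
  rw [harmonicProj, harmonicProj, ← Finset.sum_range_reflect]
  congr 1
  refine Finset.sum_congr rfl fun a ha => ?_
  rw [Finset.mem_range] at ha
  congr 1
  rw [Nat.sub_sub, Nat.cast_sub (by omega)]
  push_cast
  ring

theorem harmonicProj_im (k n : ℕ) (x : ℤ) : (harmonicProj k n x).im = 0 := by
  rw [← Complex.conj_eq_iff_im, ← Complex.star_def]
  conv_rhs => rw [← harmonicProj_neg]
  rw [harmonicProj, harmonicProj, star_mul', star_inv₀, star_natCast, star_sum]
  simp only [star_halfChar, mul_neg]

theorem harmonicProj_zero (k n : ℕ) : harmonicProj k n 0 = n / k := by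
  simp [harmonicProj, halfChar_zero, div_eq_inv_mul]

/-- Up to nonzero factors the value is a geometric sum of `n` terms with ratio a primitive `k`-th
root of unity. Its vanishing would force `k ∣ n`. -/
theorem harmonicProj_one_ne_zero {k n : ℕ} (hn : 0 < n) (hkn : n < k) :
    harmonicProj k n 1 ≠ 0 := by
  have hk : 0 < k := hn.trans hkn
  have hk' : (k : ℂ) ≠ 0 := by exact_mod_cast hk.ne'
  have h1 : harmonicProj k n 1 =
      (k : ℂ)⁻¹ * (halfChar k (1 - n) * ∑ a ∈ Finset.range n, halfChar k 2 ^ a) := by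
    rw [harmonicProj, Finset.mul_sum (Finset.range n) _ (halfChar k (1 - n))]
    congr 1
    refine Finset.sum_congr rfl fun a _ => ?_
    rw [← halfChar_nat_mul, ← halfChar_add]
    congr 1
    ring
  rw [h1]
  refine mul_ne_zero (inv_ne_zero hk') (mul_ne_zero (Complex.exp_ne_zero _) fun h => ?_)
  have h2 := geom_sum_mul (halfChar k 2) n
  rw [h, zero_mul, ← halfChar_nat_mul, mul_comm, eq_comm, sub_eq_zero,
    halfChar_two_mul_eq_one_iff hk] at h2
  exact absurd (Nat.le_of_dvd hn (Int.natCast_dvd_natCast.1 h2)) (by omega)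

theorem sum_halfChar_two_mul {k : ℕ} (hk : 0 < k) {x : ℤ} (hx : |x| < k) :
    ∑ j : Fin k, halfChar k (2 * x * j) = if x = 0 then (k : ℂ) else 0 := by
  split_ifs with h
  · simp [h, halfChar_zero]
  · have h1 : ∑ j : Fin k, halfChar k (2 * x * j) =
        ∑ j ∈ Finset.range k, halfChar k (2 * x) ^ j := by
      rw [← Fin.sum_univ_eq_sum_range]
      refine Finset.sum_congr rfl fun j _ => ?_
      rw [← halfChar_nat_mul]
      congr 1
      ring
    rw [h1]
    have h2 := geom_sum_mul (halfChar k (2 * x)) k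
    have h3 : halfChar k (2 * x) ^ k = 1 := by
      rw [← halfChar_nat_mul, mul_left_comm, halfChar_two_mul_eq_one_iff hk]
      exact dvd_mul_right _ _
    rw [h3, sub_self] at h2
    refine (mul_eq_zero.1 h2).resolve_right fun h4 => h ?_
    rw [sub_eq_zero, halfChar_two_mul_eq_one_iff hk] at h4
    exact Int.eq_zero_of_abs_lt_dvd h4 hx

/-- Orthogonality of characters: the frequencies may be half-integers, but their differences `b - a`
are integers of absolute value less than `k`, so only the terms `a = b` survive the sum over `j`. -/
theorem harmonicProj_convolution {k n : ℕ} (hk : 0 < k) (hkn : n ≤ k) (i l : ℤ) :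
    ∑ j : Fin k, harmonicProj k n (i - j) * harmonicProj k n (j - l) = harmonicProj k n (i - l) := by
  have hk' : (k : ℂ) ≠ 0 := by exact_mod_cast hk.ne'
  have h1 : ∀ j : Fin k, harmonicProj k n (i - j) * harmonicProj k n (j - l) =
      ∑ a ∈ Finset.range n, ∑ b ∈ Finset.range n, (k : ℂ)⁻¹ * (k : ℂ)⁻¹ *
        (halfChar k ((2 * a + 1 - n) * i - (2 * b + 1 - n) * l) *
          halfChar k (2 * ((b : ℤ) - a) * j)) := by
    intro j
    rw [harmonicProj, harmonicProj, mul_mul_mul_comm, Finset.sum_mul_sum, Finset.mul_sum]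
    refine Finset.sum_congr rfl fun a _ => ?_
    rw [Finset.mul_sum]
    refine Finset.sum_congr rfl fun b _ => ?_
    rw [← halfChar_add, ← halfChar_add]
    congr 2
    ring
  rw [Finset.sum_congr rfl fun j _ => h1 j, Finset.sum_comm, harmonicProj, Finset.mul_sum]
  refine Finset.sum_congr rfl fun a ha => ?_
  rw [Finset.sum_comm]
  have h2 : ∀ b ∈ Finset.range n, ∑ j : Fin k, (k : ℂ)⁻¹ * (k : ℂ)⁻¹ *
        (halfChar k ((2 * a + 1 - n) * i - (2 * b + 1 - n) * l) *
          halfChar k (2 * ((b : ℤ) - a) * j)) =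
      if b = a then (k : ℂ)⁻¹ * halfChar k ((2 * a + 1 - n) * (i - l)) else 0 := by
    intro b hb
    rw [Finset.mem_range] at ha hb
    rw [← Finset.mul_sum, ← Finset.mul_sum, sum_halfChar_two_mul hk (by rw [abs_lt]; omega)]
    by_cases hab : b = a
    · subst hab
      simp only [sub_self, if_true]
      rw [← mul_sub]
      field_simp
    · rw [if_neg (by omega), if_neg hab, mul_zero, mul_zero]
  rw [Finset.sum_congr rfl h2, Finset.sum_ite_eq' , if_pos ha]

theorem N_nonempty (𝕜 : Type*) [RCLike 𝕜] {k n : ℕ} (hn : 0 < n) (hkn : n < k) :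
    (N 𝕜 k n).Nonempty := by
  have hk : 0 < k := hn.trans hkn
  have hn' : (n : ℝ) ≠ 0 := by exact_mod_cast hn.ne'
  have hk' : (k : ℝ) ≠ 0 := by exact_mod_cast hk.ne'
  have hre : ∀ x, ((harmonicProj k n x).re : ℂ) = harmonicProj k n x := fun x =>
    Complex.ext (by simp) (by simp [harmonicProj_im])
  obtain ⟨M, hM⟩ : ∃ M : Matrix (Fin k) (Fin k) 𝕜, ∀ i j, M i j =
      ((k / n * (harmonicProj k n ((i : ℤ) - j)).re : ℝ) : 𝕜) := ⟨Matrix.of fun _ _ => _, fun _ _ => rfl⟩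
  refine ⟨M, (mem_G_iff hn hk M).2 ⟨?_, ?_, fun i => ?_⟩,
    (commPartition_eq_univ_iff hk M).2 ⟨fun _ _ _ => rfl, fun A hA i j _ hi => ?_⟩⟩
  · ext i j
    rw [Matrix.conjTranspose_apply, hM, hM]
    rw [← neg_sub, harmonicProj_neg, RCLike.star_def, RCLike.conj_ofReal]
  · ext i l
    have h := harmonicProj_convolution hk hkn.le (i : ℤ) l
    have h' : ∑ j : Fin k, (harmonicProj k n (i - j)).re * (harmonicProj k n (j - l)).re =
        (harmonicProj k n (i - l)).re := by
      apply Complex.ofReal_injective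
      push_cast
      simpa only [hre] using h
    simp only [hM, Matrix.smul_apply, Matrix.mul_apply, smul_eq_mul]
    rw [← h']
    push_cast
    rw [Finset.mul_sum, Finset.mul_sum]
    refine Finset.sum_congr rfl fun j _ => ?_
    have : (n : 𝕜) ≠ 0 := by exact_mod_cast hn.ne'
    have : (k : 𝕜) ≠ 0 := by exact_mod_cast hk.ne'
    field_simp
  · have h : (harmonicProj k n 0).re = n / k := by
      rw [harmonicProj_zero, ← Complex.ofReal_natCast, ← Complex.ofReal_natCast,
        ← Complex.ofReal_div, Complex.ofReal_re]
    simp only [hM, sub_self, h]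
    rw [div_mul_div_comm, mul_comm, div_self (mul_ne_zero hn' hk')]
    simp
  -- The entry linking consecutive indices is a nonzero multiple of the kernel at `1`, so the graph
  -- contains a path through all indices.
  · have hstep : ∀ m (hm : m + 1 < k), (⟨m + 1, hm⟩ : Fin k) ∈ A ↔ (⟨m, by omega⟩ : Fin k) ∈ A := by
      intro m hm
      apply hA
      have h1 : (harmonicProj k n 1).re ≠ 0 := fun h =>
        harmonicProj_one_ne_zero hn hkn (by rw [← hre, h, Complex.ofReal_zero])
      simp only [hM]
      rw [Nat.cast_add, Nat.cast_one, add_sub_cancel_left]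
      simpa using ⟨⟨hk.ne', hn.ne'⟩, h1⟩
    have hall : ∀ m (hm : m < k), (⟨m, hm⟩ : Fin k) ∈ A ↔ (⟨0, hk⟩ : Fin k) ∈ A := by
      intro m
      induction m with
      | zero => exact fun _ => Iff.rfl
      | succ m ih => exact fun hm => (hstep m hm).trans (ih _)
    exact (hall j j.2).2 ((hall i i.2).1 hi)

end TightFrame

/-! ### Tangent vectors with prescribed diagonal, via a graph Laplacian -/

namespace TightFrame

/-- If the only function that is constant along the edges of a weighted graph and vanishes on the
set `s` is zero, then the graph Laplacian takes arbitrary values off `s`. -/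
theorem exists_laplacian_eq {ι : Type*} [Fintype ι] (w : ι → ι → ℝ) (s : ι → Prop)
    (hsymm : ∀ i j, w i j = w j i) (hnonneg : ∀ i j, 0 ≤ w i j)
    (hconn : ∀ c : ι → ℝ, (∀ i j, w i j ≠ 0 → c i = c j) → (∀ i, s i → c i = 0) → c = 0)
    (v : ι → ℝ) : ∃ c : ι → ℝ, ∀ i, ¬ s i → ∑ j, w i j * (c i - c j) = v i := by
  classical
  -- The Dirichlet problem with boundary `s`. As `Λ` is an endomorphism of a finite-dimensional
  -- space, uniqueness suffices, and this follows from the energy `∑ w i j (c i - c j)²` vanishing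
  -- on the kernel.
  let Λ : (ι → ℝ) →ₗ[ℝ] (ι → ℝ) :=
    { toFun := fun c i => if s i then c i else ∑ j, w i j * (c i - c j)
      map_add' := fun c c' => by
        ext i
        by_cases h : s i
        · simp [h]
        · simp only [h, if_false, Pi.add_apply, ← Finset.sum_add_distrib]
          exact Finset.sum_congr rfl fun j _ => by ring
      map_smul' := fun a c => by
        ext i
        by_cases h : s i
        · simp [h]
        · simp only [h, if_false, Pi.smul_apply, smul_eq_mul, RingHom.id_apply, Finset.mul_sum]
          exact Finset.sum_congr rfl fun j _ => by ring }
  have hinj : Function.Injective Λ := by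
    rw [← LinearMap.ker_eq_bot, LinearMap.ker_eq_bot']
    intro c hc
    have hc' : ∀ i, (if s i then c i else ∑ j, w i j * (c i - c j)) = 0 := fun i => congrFun hc i
    have hs : ∀ i, s i → c i = 0 := fun i hi => by simpa [hi] using hc' i
    refine hconn c ?_ hs
    have h1 : ∑ i, ∑ j, c i * (w i j * (c i - c j)) = 0 := by
      refine Finset.sum_eq_zero fun i _ => ?_
      rw [← Finset.mul_sum]
      by_cases hi : s i
      · rw [hs i hi, zero_mul]
      · have := hc' i
        rw [if_neg hi] at this
        rw [this, mul_zero]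
    have h2 : ∑ i, ∑ j, w i j * (c i - c j) ^ 2 = 0 := by
      have h3 : ∑ i, ∑ j, c j * (w i j * (c i - c j)) =
          -∑ i, ∑ j, c i * (w i j * (c i - c j)) := by
        rw [Finset.sum_comm, ← Finset.sum_neg_distrib]
        refine Finset.sum_congr rfl fun i _ => ?_
        rw [← Finset.sum_neg_distrib]
        refine Finset.sum_congr rfl fun j _ => ?_
        rw [hsymm j i]
        ring
      have h4 : ∑ i, ∑ j, w i j * (c i - c j) ^ 2 =
          ∑ i, ∑ j, c i * (w i j * (c i - c j)) - ∑ i, ∑ j, c j * (w i j * (c i - c j)) := by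
        rw [← Finset.sum_sub_distrib]
        refine Finset.sum_congr rfl fun i _ => ?_
        rw [← Finset.sum_sub_distrib]
        exact Finset.sum_congr rfl fun j _ => by ring
      rw [h4, h3, h1]
      simp
    have hterm : ∀ i j, 0 ≤ w i j * (c i - c j) ^ 2 := fun i j =>
      mul_nonneg (hnonneg i j) (sq_nonneg _)
    intro i j hij
    have h5 := (Finset.sum_eq_zero_iff_of_nonneg fun i _ =>
      Finset.sum_nonneg fun j _ => hterm i j).1 h2 i (Finset.mem_univ i)
    have h6 := (Finset.sum_eq_zero_iff_of_nonneg fun j _ => hterm i j).1 h5 j (Finset.mem_univ j)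
    have h7 := (mul_eq_zero.1 h6).resolve_left hij
    exact sub_eq_zero.1 (pow_eq_zero_iff (two_ne_zero)|>.1 h7)
  obtain ⟨c, hc⟩ := (LinearMap.injective_iff_surjective.1 hinj) v
  refine ⟨c, fun i hi => ?_⟩
  have h := congrFun hc i
  change (if s i then c i else ∑ j, w i j * (c i - c j)) = v i at h
  rwa [if_neg hi] at h

/-- The entries of `X` vanish off the diagonal blocks of the labelling `b`. -/
def BlockDiag {𝕜 β : Type*} [Zero 𝕜] {k : ℕ} (b : Fin k → β) (X : Matrix (Fin k) (Fin k) 𝕜) :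
    Prop :=
  ∀ i j, b i ≠ b j → X i j = 0

section
variable {𝕜 β : Type*} [RCLike 𝕜] {k : ℕ} {b : Fin k → β} {X Y P : Matrix (Fin k) (Fin k) 𝕜}

theorem BlockDiag.add (hX : BlockDiag b X) (hY : BlockDiag b Y) : BlockDiag b (X + Y) :=
  fun i j h => by rw [Matrix.add_apply, hX i j h, hY i j h, add_zero]

theorem BlockDiag.sub (hX : BlockDiag b X) (hY : BlockDiag b Y) : BlockDiag b (X - Y) :=
  fun i j h => by rw [Matrix.sub_apply, hX i j h, hY i j h, sub_zero]

theorem BlockDiag.smul (hX : BlockDiag b X) (a : ℝ) : BlockDiag b (a • X) :=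
  fun i j h => by rw [Matrix.smul_apply, hX i j h, smul_zero]

theorem BlockDiag.conjTranspose (hX : BlockDiag b X) : BlockDiag b X.conjTranspose :=
  fun i j h => by rw [Matrix.conjTranspose_apply, hX j i h.symm, star_zero]

theorem BlockDiag.mul (hX : BlockDiag b X) (hY : BlockDiag b Y) : BlockDiag b (X * Y) := by
  intro i j h
  rw [Matrix.mul_apply]
  refine Finset.sum_eq_zero fun l _ => ?_
  by_cases hl : b i = b l
  · rw [hY l j (hl ▸ h), mul_zero]
  · rw [hX i l hl, zero_mul]

theorem blockDiag_one : BlockDiag b (1 : Matrix (Fin k) (Fin k) 𝕜) := fun _ _ h =>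
  Matrix.one_apply_ne fun hij => h (congrArg b hij)

theorem blockDiag_diagonal (d : Fin k → 𝕜) : BlockDiag b (Matrix.diagonal d) := fun _ _ h =>
  Matrix.diagonal_apply_ne _ fun hij => h (congrArg b hij)

open Classical in
/-- The projection of matrices onto the block diagonal ones. -/
noncomputable def blockCompress (𝕜 : Type*) [RCLike 𝕜] (b : Fin k → β) :
    Matrix (Fin k) (Fin k) 𝕜 →ₗ[𝕜] Matrix (Fin k) (Fin k) 𝕜 where
  toFun X := Matrix.of fun i j => if b i = b j then X i j else 0
  map_add' X Y := by ext i j; by_cases h : b i = b j <;> simp [h]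
  map_smul' a X := by ext i j; by_cases h : b i = b j <;> simp [h]

open Classical in
theorem blockCompress_apply (X : Matrix (Fin k) (Fin k) 𝕜) (i j : Fin k) :
    blockCompress 𝕜 b X i j = if b i = b j then X i j else 0 := rfl

theorem blockDiag_blockCompress (X : Matrix (Fin k) (Fin k) 𝕜) :
    BlockDiag b (blockCompress 𝕜 b X) := fun i j h => by rw [blockCompress_apply, if_neg h]

theorem BlockDiag.blockCompress_eq (hX : BlockDiag b X) : blockCompress 𝕜 b X = X := by
  ext i j
  rw [blockCompress_apply]
  split_ifs with h
  · rfl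
  · exact (hX i j h).symm

/-- The projection of matrices onto the Hermitian block diagonal ones. -/
noncomputable def hermBlock (𝕜 : Type*) [RCLike 𝕜] (b : Fin k → β) :
    Matrix (Fin k) (Fin k) 𝕜 →ₗ[ℝ] Matrix (Fin k) (Fin k) 𝕜 where
  toFun X := (1 / 2 : ℝ) • (blockCompress 𝕜 b X + (blockCompress 𝕜 b X).conjTranspose)
  map_add' X Y := by
    rw [map_add, Matrix.conjTranspose_add]
    module
  map_smul' a X := by
    rw [← algebraMap_smul 𝕜 a X, map_smul, algebraMap_smul, Matrix.conjTranspose_smul,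
      star_trivial, RingHom.id_apply]
    module

theorem hermBlock_apply (X : Matrix (Fin k) (Fin k) 𝕜) : hermBlock 𝕜 b X =
    (1 / 2 : ℝ) • (blockCompress 𝕜 b X + (blockCompress 𝕜 b X).conjTranspose) := rfl

theorem conjTranspose_hermBlock (X : Matrix (Fin k) (Fin k) 𝕜) :
    (hermBlock 𝕜 b X).conjTranspose = hermBlock 𝕜 b X := by
  rw [hermBlock_apply, Matrix.conjTranspose_smul, Matrix.conjTranspose_add,
    Matrix.conjTranspose_conjTranspose, star_trivial, add_comm]

theorem blockDiag_hermBlock (X : Matrix (Fin k) (Fin k) 𝕜) : BlockDiag b (hermBlock 𝕜 b X) :=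
  ((blockDiag_blockCompress X).add (blockDiag_blockCompress X).conjTranspose).smul _

theorem hermBlock_eq_iff :
    hermBlock 𝕜 b X = X ↔ X.conjTranspose = X ∧ BlockDiag b X := by
  constructor
  · intro h
    rw [← h]
    exact ⟨conjTranspose_hermBlock X, blockDiag_hermBlock X⟩
  · rintro ⟨h1, h2⟩
    rw [hermBlock_apply, h2.blockCompress_eq, h1]
    module

theorem hermBlock_hermBlock (X : Matrix (Fin k) (Fin k) 𝕜) :
    hermBlock 𝕜 b (hermBlock 𝕜 b X) = hermBlock 𝕜 b X :=
  hermBlock_eq_iff.2 ⟨conjTranspose_hermBlock X, blockDiag_hermBlock X⟩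

/-- The two-sided compression by `Q`, as a real linear map. -/
noncomputable def sandwich (Q : Matrix (Fin k) (Fin k) 𝕜) :
    Matrix (Fin k) (Fin k) 𝕜 →ₗ[ℝ] Matrix (Fin k) (Fin k) 𝕜 :=
  LinearMap.mulLeft ℝ Q ∘ₗ LinearMap.mulRight ℝ Q

theorem sandwich_apply (Q X : Matrix (Fin k) (Fin k) 𝕜) : sandwich Q X = Q * (X * Q) := rfl

theorem hermBlock_sandwich {Q : Matrix (Fin k) (Fin k) 𝕜} (hQ : Q.conjTranspose = Q)
    (hQb : BlockDiag b Q) (hX : hermBlock 𝕜 b X = X) :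
    hermBlock 𝕜 b (sandwich Q X) = sandwich Q X := by
  obtain ⟨h1, h2⟩ := hermBlock_eq_iff.1 hX
  refine hermBlock_eq_iff.2 ⟨?_, hQb.mul (h2.mul hQb)⟩
  rw [sandwich_apply, Matrix.conjTranspose_mul, Matrix.conjTranspose_mul, hQ, h1,
    Matrix.mul_assoc]

/-- The real parts of the diagonal entries off the set `s`. -/
noncomputable def reDiag (𝕜 : Type*) [RCLike 𝕜] (s : Fin k → Prop) :
    Matrix (Fin k) (Fin k) 𝕜 →ₗ[ℝ] ({i // ¬ s i} → ℝ) where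
  toFun X i := RCLike.re (X i i)
  map_add' X Y := by ext i; simp
  map_smul' a X := by ext i; simp [RCLike.smul_re]

theorem reDiag_apply (s : Fin k → Prop) (X : Matrix (Fin k) (Fin k) 𝕜) (i : {i // ¬ s i}) :
    reDiag 𝕜 s X i = RCLike.re (X i i) := rfl

/-- The linear map whose kernel is the tangent space at `P` to the manifold of Hermitian block
diagonal projections. -/
noncomputable def projDeriv (b : Fin k → β) (P : Matrix (Fin k) (Fin k) 𝕜) :
    Matrix (Fin k) (Fin k) 𝕜 →ₗ[ℝ] Matrix (Fin k) (Fin k) 𝕜 :=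
  LinearMap.id - hermBlock 𝕜 b + (sandwich P + sandwich (1 - P)) ∘ₗ hermBlock 𝕜 b

theorem projDeriv_apply (P X : Matrix (Fin k) (Fin k) 𝕜) : projDeriv b P X =
    X - hermBlock 𝕜 b X +
      (sandwich P (hermBlock 𝕜 b X) + sandwich (1 - P) (hermBlock 𝕜 b X)) := rfl

theorem conjTranspose_one_sub (hP : P.conjTranspose = P) : (1 - P).conjTranspose = 1 - P := by
  rw [Matrix.conjTranspose_sub, Matrix.conjTranspose_one, hP]

theorem mem_ker_projDeriv (hP : P.conjTranspose = P) (hPb : BlockDiag b P)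
    (X : Matrix (Fin k) (Fin k) 𝕜) : X ∈ LinearMap.ker (projDeriv b P) ↔
      hermBlock 𝕜 b X = X ∧ sandwich P X + sandwich (1 - P) X = 0 := by
  rw [LinearMap.mem_ker, projDeriv_apply]
  constructor
  · intro h
    have h1 := congrArg (hermBlock 𝕜 b) h
    rw [map_add, map_add, map_sub, hermBlock_hermBlock, sub_self, zero_add, map_zero,
      hermBlock_sandwich hP hPb (hermBlock_hermBlock X),
      hermBlock_sandwich (conjTranspose_one_sub hP) (blockDiag_one.sub hPb)
        (hermBlock_hermBlock X)] at h1
    rw [h1, add_zero, sub_eq_zero] at h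
    rw [← h] at h1
    exact ⟨h.symm, h1⟩
  · rintro ⟨h1, h2⟩
    rw [h1, h2, sub_self, add_zero]

/-- Tangent vectors at `P` to the manifold of block diagonal projections have arbitrary diagonal
entries off a set of representatives of the blocks. -/
theorem exists_tangent_reDiag_eq (hP : P.conjTranspose = P) (hPP : P * P = P)
    (hPb : BlockConn b P) {s : Fin k → Prop} (hs : ∀ i, ∃ j, b j = b i ∧ s j)
    (v : {i // ¬ s i} → ℝ) :
    ∃ t ∈ LinearMap.ker (projDeriv b P), reDiag 𝕜 s t = v := by
  classical
  have hBD : BlockDiag b P := fun i j h => by_contra fun h' => h (hPb.1 i j h')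
  have hsw : ∀ i j, P j i = star (P i j) := fun i j => by
    conv_lhs => rw [← hP]
    rfl
  obtain ⟨d, hd⟩ := exists_laplacian_eq (fun i j => ‖P i j‖ ^ 2) s
    (fun i j => by simp only [hsw i j, norm_star]) (fun i j => sq_nonneg _)
    (fun c hc hcs => by
      funext i
      obtain ⟨j, hj, hjs⟩ := hs i
      have hInv : Inv P (Finset.univ.filter fun l => c l = c j) := by
        intro l m hlm
        rw [Finset.mem_filter, Finset.mem_filter,
          hc l m (pow_ne_zero 2 (norm_ne_zero_iff.2 hlm))]
        simp
      have := hPb.2 _ hInv j i hj (by simp)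
      rw [Finset.mem_filter] at this
      rw [this.2, hcs j hjs, Pi.zero_apply])
    (fun i => if h : s i then 0 else v ⟨i, h⟩ / 2)
  let Δ : Matrix (Fin k) (Fin k) 𝕜 := Matrix.diagonal fun i => (d i : 𝕜)
  have hΔ : Δ.conjTranspose = Δ := by
    simp only [Δ, Matrix.diagonal_conjTranspose]
    congr 1
    ext i
    simp
  have hΔb : BlockDiag b Δ := blockDiag_diagonal _
  -- This is `PΔ(1-P) + (1-P)ΔP`, which has no diagonal corners. Since `∑ j, |P i j|² = P i i`, its
  -- `i`-th diagonal entry is `2 ∑ j, |P i j|² (d i - d j)`; hence the `v / 2` in the choice of `d`.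
  refine ⟨P * Δ + Δ * P - (2 : ℝ) • (P * (Δ * P)), ?_, ?_⟩
  · rw [mem_ker_projDeriv hP hBD, hermBlock_eq_iff]
    refine ⟨⟨?_, ((hBD.mul hΔb).add (hΔb.mul hBD)).sub ((hBD.mul (hΔb.mul hBD)).smul 2)⟩, ?_⟩
    · simp only [Matrix.conjTranspose_sub, Matrix.conjTranspose_add, Matrix.conjTranspose_mul,
        Matrix.conjTranspose_smul, hP, hΔ, star_trivial, Matrix.mul_assoc]
      rw [add_comm]
    · have hPP' : ∀ Z, P * (P * Z) = P * Z := fun Z => by rw [← mul_assoc, hPP]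
      simp only [sandwich_apply, mul_add, mul_sub, add_mul, sub_mul, mul_assoc, hPP, hPP',
        one_mul, mul_one, two_smul]
      abel
  · ext i
    have h1 : ∑ j, ‖P i j‖ ^ 2 = RCLike.re (P i i) := by
      conv_rhs => rw [← hPP, Matrix.mul_apply, map_sum]
      refine Finset.sum_congr rfl fun j _ => ?_
      rw [hsw i j, RCLike.star_def, RCLike.mul_conj]
      norm_cast
    have h2 : RCLike.re ((P * (Δ * P)) i i) = ∑ j, ‖P i j‖ ^ 2 * d j := by
      rw [Matrix.mul_apply, map_sum]
      refine Finset.sum_congr rfl fun j _ => ?_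
      simp only [Δ, Matrix.diagonal_mul]
      rw [hsw i j, mul_left_comm, RCLike.star_def, RCLike.mul_conj, RCLike.re_ofReal_mul]
      norm_cast
      ring
    have h3 := hd i i.2
    rw [dif_neg i.2] at h3
    simp only [mul_sub, Finset.sum_sub_distrib, ← Finset.sum_mul, h1] at h3
    rw [reDiag_apply, Matrix.sub_apply, Matrix.add_apply, Matrix.smul_apply, map_sub, map_add,
      RCLike.smul_re, h2]
    simp only [Δ, Matrix.diagonal_mul, Matrix.mul_diagonal, RCLike.re_mul_ofReal,
      RCLike.re_ofReal_mul]
    linarith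

end

end TightFrame

/-! ### Dimension of the tangent space -/

namespace TightFrame

section
variable {𝕜 β : Type*} [RCLike 𝕜] {k : ℕ} {b : Fin k → β} {P : Matrix (Fin k) (Fin k) 𝕜}

/-- The projection onto the block diagonal matrices mapping the kernel of the projection `P` into
its range. -/
noncomputable def offProj (b : Fin k → β) (P : Matrix (Fin k) (Fin k) 𝕜) :
    Matrix (Fin k) (Fin k) 𝕜 →ₗ[𝕜] Matrix (Fin k) (Fin k) 𝕜 :=
  LinearMap.mulLeft 𝕜 P ∘ₗ LinearMap.mulRight 𝕜 (1 - P) ∘ₗ blockCompress 𝕜 b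

theorem offProj_apply (X : Matrix (Fin k) (Fin k) 𝕜) :
    offProj b P X = P * (blockCompress 𝕜 b X * (1 - P)) := rfl

theorem blockDiag_offProj (hPb : BlockDiag b P) (X : Matrix (Fin k) (Fin k) 𝕜) :
    BlockDiag b (offProj b P X) :=
  hPb.mul ((blockDiag_blockCompress X).mul (blockDiag_one.sub hPb))

theorem mul_offProj (hPP : P * P = P) (X : Matrix (Fin k) (Fin k) 𝕜) :
    P * offProj b P X = offProj b P X := by
  rw [offProj_apply, ← mul_assoc, hPP]

theorem offProj_mul (hPP : P * P = P) (X : Matrix (Fin k) (Fin k) 𝕜) :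
    offProj b P X * P = 0 := by
  rw [offProj_apply, mul_assoc, mul_assoc, sub_mul, one_mul, hPP, sub_self, mul_zero, mul_zero]

theorem isIdempotentElem_offProj (hPP : P * P = P) (hPb : BlockDiag b P) :
    IsIdempotentElem (offProj b P) := by
  ext1 X
  rw [Module.End.mul_apply]
  conv_lhs => rw [offProj_apply, (blockDiag_offProj hPb X).blockCompress_eq]
  rw [mul_sub, mul_one, offProj_mul hPP, sub_zero, mul_offProj hPP]

-- Each matrix unit `(i, j)` with `b i = b j` contributes `P i i * (1 - P j j)` to the trace; the
-- others contribute nothing.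
open Classical in
theorem trace_offProj {c : 𝕜} (hc : ∀ i, P i i = c) :
    LinearMap.trace 𝕜 _ (offProj b P) =
      ((Finset.univ.filter fun q : Fin k × Fin k => b q.1 = b q.2).card : 𝕜) * (c * (1 - c)) := by
  rw [LinearMap.trace_eq_matrix_trace 𝕜 (Matrix.stdBasis 𝕜 (Fin k) (Fin k)), Matrix.trace,
    Finset.card_filter, Nat.cast_sum, Finset.sum_mul]
  refine Finset.sum_congr rfl fun q _ => ?_
  obtain ⟨i, j⟩ := q
  have hE : blockCompress 𝕜 b (Matrix.single i j (1 : 𝕜)) =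
      if b i = b j then Matrix.single i j 1 else 0 := by
    ext l m
    rw [blockCompress_apply, Matrix.single_apply]
    by_cases h : i = l ∧ j = m
    · obtain ⟨rfl, rfl⟩ := h
      by_cases h' : b i = b j <;> simp [h']
    · by_cases h' : b i = b j <;> simp [h', h]
  rw [Matrix.diag_apply, LinearMap.toMatrix_apply, Matrix.stdBasis_eq_single, offProj_apply, hE]
  have hrepr : ∀ X : Matrix (Fin k) (Fin k) 𝕜,
      (Matrix.stdBasis 𝕜 (Fin k) (Fin k)).repr X (i, j) = X i j := fun X => by
    simp [Matrix.stdBasis]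
  rw [hrepr]
  split_ifs with h
  · rw [Matrix.mul_apply, Finset.sum_eq_single i]
    · rw [Matrix.single_mul_apply_same, Matrix.sub_apply, Matrix.one_apply_eq, hc, hc]
      simp
    · intro l _ hl
      rw [Matrix.single_mul_apply_of_ne _ _ _ _ _ hl, mul_zero]
    · simp
  · simp

/-- Hermitian tangent vectors correspond to their upper right corners. -/
theorem finrank_ker_projDeriv (hP : P.conjTranspose = P) (hPP : P * P = P)
    (hPb : BlockDiag b P) :
    Module.finrank ℝ (LinearMap.ker (projDeriv b P)) =
      Module.finrank ℝ 𝕜 * Module.finrank 𝕜 (LinearMap.range (offProj b P)) := by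
  rw [Module.finrank_mul_finrank ℝ 𝕜]
  have hrange : ∀ X ∈ LinearMap.range (offProj b P), BlockDiag b X ∧ P * X = X ∧ X * P = 0 := by
    rintro _ ⟨X, rfl⟩
    exact ⟨blockDiag_offProj hPb X, mul_offProj hPP X, offProj_mul hPP X⟩
  have hoff : ∀ X, BlockDiag b X → offProj b P X = P * (X * (1 - P)) := fun X hX => by
    rw [offProj_apply, hX.blockCompress_eq]
  have hadd : ∀ X : LinearMap.range (offProj b P),
      (X : Matrix (Fin k) (Fin k) 𝕜) + (X : Matrix (Fin k) (Fin k) 𝕜).conjTranspose ∈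
        LinearMap.ker (projDeriv b P) := by
    intro X
    obtain ⟨h1, h2, h3⟩ := hrange X X.2
    have h4 : (X : Matrix (Fin k) (Fin k) 𝕜).conjTranspose * P =
        (X : Matrix (Fin k) (Fin k) 𝕜).conjTranspose := by
      conv_rhs => rw [← h2, Matrix.conjTranspose_mul, hP]
    have h5 : P * (X : Matrix (Fin k) (Fin k) 𝕜).conjTranspose = 0 := by
      have := congrArg Matrix.conjTranspose h3
      rwa [Matrix.conjTranspose_mul, hP, Matrix.conjTranspose_zero] at this
    rw [mem_ker_projDeriv hP hPb, hermBlock_eq_iff]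
    refine ⟨⟨?_, h1.add h1.conjTranspose⟩, ?_⟩
    · rw [Matrix.conjTranspose_add, Matrix.conjTranspose_conjTranspose, add_comm]
    · simp only [sandwich_apply, add_mul, mul_add, mul_sub, sub_mul, mul_one, one_mul, h2, h3, h4,
        h5]
      simp
  -- The mutually inverse maps are `X ↦ P X (1-P)` and `Y ↦ Y + Yᴴ`. They are only real linear,
  -- because of the conjugation.
  refine LinearEquiv.finrank_eq (LinearEquiv.ofLinearMap
    (((offProj b P).rangeRestrict.restrictScalars ℝ) ∘ₗ (LinearMap.ker (projDeriv b P)).subtype)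
    ({ toFun := fun X => ⟨_, hadd X⟩
       map_add' := fun X Y => Subtype.ext ?_
       map_smul' := fun a X => Subtype.ext ?_ } :
      LinearMap.range (offProj b P) →ₗ[ℝ] LinearMap.ker (projDeriv b P)) ?_ ?_)
  · simp only [Submodule.coe_add, Matrix.conjTranspose_add]
    abel
  · change (a • (X : Matrix (Fin k) (Fin k) 𝕜)) + (a • (X : Matrix (Fin k) (Fin k) 𝕜)).conjTranspose
      = a • ((X : Matrix (Fin k) (Fin k) 𝕜) + (X : Matrix (Fin k) (Fin k) 𝕜).conjTranspose)
    rw [Matrix.conjTranspose_smul, star_trivial, smul_add]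
  · ext1 X
    apply Subtype.ext
    obtain ⟨h1, h2, h3⟩ := hrange X X.2
    have h5 : P * (X : Matrix (Fin k) (Fin k) 𝕜).conjTranspose = 0 := by
      have := congrArg Matrix.conjTranspose h3
      rwa [Matrix.conjTranspose_mul, hP, Matrix.conjTranspose_zero] at this
    change offProj b P ((X : Matrix (Fin k) (Fin k) 𝕜) +
      (X : Matrix (Fin k) (Fin k) 𝕜).conjTranspose) = X
    rw [hoff _ (h1.add h1.conjTranspose), ← mul_assoc, mul_add, h5, add_zero, h2, mul_sub, mul_one,
      h3, sub_zero]
  · ext1 X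
    apply Subtype.ext
    obtain ⟨X, hX⟩ := X
    obtain ⟨h1, h2⟩ := (mem_ker_projDeriv hP hPb _).1 hX
    obtain ⟨h3, h4⟩ := hermBlock_eq_iff.1 h1
    change offProj b P X + (offProj b P X).conjTranspose = X
    have h5 : offProj b P X + (offProj b P X).conjTranspose =
        X - (sandwich P X + sandwich (1 - P) X) := by
      rw [hoff _ h4, Matrix.conjTranspose_mul, Matrix.conjTranspose_mul, h3, hP,
        conjTranspose_one_sub hP]
      simp only [sandwich_apply]
      noncomm_ring
    rw [h5, h2, sub_zero]

end

end TightFrame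

/-! ### Local quadratic equations for projections and rigidity of block traces -/

namespace TightFrame

open Filter Topology

theorem finrank_ker_prod_add {V V' W : Type*} [AddCommGroup V] [Module ℝ V]
    [FiniteDimensional ℝ V] [AddCommGroup V'] [Module ℝ V'] [AddCommGroup W] [Module ℝ W]
    (D : V →ₗ[ℝ] V') (δ : V →ₗ[ℝ] W) (h : ∀ w, ∃ t ∈ LinearMap.ker D, δ t = w) :
    Module.finrank ℝ (LinearMap.ker (D.prod δ)) + Module.finrank ℝ W =
      Module.finrank ℝ (LinearMap.ker D) := by
  let f := δ ∘ₗ (LinearMap.ker D).subtype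
  have hf : LinearMap.range f = ⊤ := LinearMap.range_eq_top.2 fun w => by
    obtain ⟨t, ht, rfl⟩ := h w
    exact ⟨⟨t, ht⟩, rfl⟩
  have h1 := LinearMap.finrank_range_add_finrank_ker f
  rw [hf, finrank_top] at h1
  have h2 : LinearMap.ker (D.prod δ) = (LinearMap.ker f).map (LinearMap.ker D).subtype := by
    ext x
    simp [f, LinearMap.ker_prod, and_comm]
  rw [h2, Submodule.finrank_map_subtype_eq, add_comm, h1]

section
variable {𝕜 β : Type*} [RCLike 𝕜] {k : ℕ} {b : Fin k → β} {P : Matrix (Fin k) (Fin k) 𝕜}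

open Classical in
theorem finrank_range_offProj {c : 𝕜} (hPP : P * P = P) (hPb : BlockDiag b P)
    (hc : ∀ i, P i i = c) :
    (Module.finrank 𝕜 (LinearMap.range (offProj b P)) : 𝕜) =
      ((Finset.univ.filter fun q : Fin k × Fin k => b q.1 = b q.2).card : 𝕜) * (c * (1 - c)) := by
  rw [← trace_offProj (b := b) hc,
    (LinearMap.isProj_range_iff_isIdempotentElem _).2 (isIdempotentElem_offProj hPP hPb) |>.trace]

/-- The quadratic part of the equation of Hermitian block diagonal projections at `P`. -/
noncomputable def projQuad (b : Fin k → β) (P : Matrix (Fin k) (Fin k) 𝕜) (c : ℝ) :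
    Matrix (Fin k) (Fin k) 𝕜 →ₗ[ℝ] Matrix (Fin k) (Fin k) 𝕜 →ₗ[ℝ] Matrix (Fin k) (Fin k) 𝕜 :=
  LinearMap.compr₂ ((LinearMap.mul ℝ (Matrix (Fin k) (Fin k) 𝕜)).compl₁₂ (hermBlock 𝕜 b)
    (hermBlock 𝕜 b)) (c • (sandwich P - sandwich (1 - P)))

theorem projQuad_apply (c : ℝ) (X Y : Matrix (Fin k) (Fin k) 𝕜) : projQuad b P c X Y =
    c • (sandwich P (hermBlock 𝕜 b X * hermBlock 𝕜 b Y) -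
      sandwich (1 - P) (hermBlock 𝕜 b X * hermBlock 𝕜 b Y)) := rfl

/-- With `h` the Hermitian block part of `x - p`, the defect `z = c y² - y` at `y = p + h` equals
`Ph + hP - h + c h²`. Its corners have linear parts `PhP` and `-(1-P)h(1-P)`; taking their
difference gives both a plus sign, as in `projDeriv`. -/
theorem projDeriv_add_projQuad {c : ℝ} {p : Matrix (Fin k) (Fin k) 𝕜} (hp : hermBlock 𝕜 b p = p)
    (hpp : c • (p * p) = p) (hP : P = c • p) (x : Matrix (Fin k) (Fin k) 𝕜) :
    projDeriv b P (x - p) + projQuad b P c (x - p) (x - p) = x - hermBlock 𝕜 b x +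
      (sandwich P (c • (hermBlock 𝕜 b x * hermBlock 𝕜 b x) - hermBlock 𝕜 b x) -
        sandwich (1 - P) (c • (hermBlock 𝕜 b x * hermBlock 𝕜 b x) - hermBlock 𝕜 b x)) := by
  have hPP : P * P = P := by rw [hP, smul_mul_assoc, mul_smul_comm, hpp]
  have hPP' : ∀ Z, P * (P * Z) = P * Z := fun Z => by rw [← mul_assoc, hPP]
  obtain ⟨h, hh⟩ : ∃ h, hermBlock 𝕜 b x = p + h := ⟨hermBlock 𝕜 b x - p, by abel⟩
  have hz : c • ((p + h) * (p + h)) - (p + h) = P * h + h * P - h + c • (h * h) := by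
    rw [add_mul, mul_add, mul_add, smul_add, smul_add, smul_add, hpp, hP, smul_mul_assoc,
      mul_smul_comm]
    abel
  have hx : hermBlock 𝕜 b (x - p) = h := by rw [map_sub, hh, hp]; abel
  rw [projDeriv_apply, projQuad_apply, hx, hh, hz]
  generalize h * h = g
  simp only [sandwich_apply, mul_add, mul_sub, add_mul, sub_mul, mul_assoc, hPP, hPP',
    smul_mul_assoc, mul_smul_comm, one_mul, mul_one, smul_sub]
  abel

/-- The quadratic part takes values in Hermitian block diagonal matrices without off-diagonal
corners, and `projDeriv` is the identity there. This supplies the range condition of the chart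
criterion. -/
theorem projQuad_mem_range (hP : P.conjTranspose = P) (hPP : P * P = P) (hPb : BlockDiag b P)
    (c : ℝ) (X : Matrix (Fin k) (Fin k) 𝕜) :
    projDeriv b P (projQuad b P c X X) = projQuad b P c X X := by
  have hQ := conjTranspose_one_sub hP
  have hQb : BlockDiag b (1 - P) := blockDiag_one.sub hPb
  have h1 : hermBlock 𝕜 b (hermBlock 𝕜 b X * hermBlock 𝕜 b X) =
      hermBlock 𝕜 b X * hermBlock 𝕜 b X := by
    refine hermBlock_eq_iff.2 ⟨?_, (blockDiag_hermBlock X).mul (blockDiag_hermBlock X)⟩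
    rw [Matrix.conjTranspose_mul, conjTranspose_hermBlock]
  rw [projQuad_apply]
  generalize hermBlock 𝕜 b X * hermBlock 𝕜 b X = g at h1
  have hPP' : ∀ Z, P * (P * Z) = P * Z := fun Z => by rw [← mul_assoc, hPP]
  rw [projDeriv_apply, map_smul, map_sub, hermBlock_sandwich hP hPb h1,
    hermBlock_sandwich hQ hQb h1, sub_self, zero_add]
  simp only [sandwich_apply, mul_sub, sub_mul, mul_assoc, hPP, hPP',
    smul_mul_assoc, mul_smul_comm, one_mul, mul_one, smul_sub]
  abel

/-- Near a scaled projection `p`, the off-diagonal corners of the projection equation are a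
consequence of the diagonal ones. -/
theorem eventually_isProj {c : ℝ} {p : Matrix (Fin k) (Fin k) 𝕜} (hP : P.conjTranspose = P)
    (hPP : P * P = P) (hPp : P = c • p) :
    ∀ᶠ x in 𝓝 p, x.conjTranspose = x →
      sandwich P (c • (x * x) - x) - sandwich (1 - P) (c • (x * x) - x) = 0 →
      c • (x * x) = x := by
  let B : Matrix (Fin k) (Fin k) 𝕜 →ₗ[ℝ] Matrix (Fin k) (Fin k) 𝕜 →ₗ[ℝ]
      Matrix (Fin k) (Fin k) 𝕜 :=
    c • (LinearMap.mul ℝ (Matrix (Fin k) (Fin k) 𝕜)).flip ∘ₗ sandwich (1 - P) -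
      c • LinearMap.mul ℝ (Matrix (Fin k) (Fin k) 𝕜) ∘ₗ sandwich P
  have hB : ∀ Δ a, B Δ a = c • (a * ((1 - P) * (Δ * (1 - P)))) - c • (P * (Δ * P) * a) :=
    fun Δ a => rfl
  filter_upwards [eventually_eq_zero_of_fixed B p] with x hx hxx hz
  have hPP' : ∀ Z, P * (P * Z) = P * Z := fun Z => by rw [← mul_assoc, hPP]
  have hQP : (1 - P) * P = 0 := by rw [sub_mul, one_mul, hPP, sub_self]
  have hPQ : P * (1 - P) = 0 := by rw [mul_sub, mul_one, hPP, sub_self]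
  have hQQ : (1 - P) * (1 - P) = 1 - P := by rw [mul_sub, mul_one, hQP, sub_zero]
  have hcomm : x * (c • (x * x) - x) = (c • (x * x) - x) * x := by
    rw [mul_sub, sub_mul, mul_smul_comm, smul_mul_assoc, mul_assoc]
  have hzz : (c • (x * x) - x).conjTranspose = c • (x * x) - x := by
    rw [Matrix.conjTranspose_sub, Matrix.conjTranspose_smul, Matrix.conjTranspose_mul, hxx,
      star_trivial]
  obtain ⟨Δ, hΔ⟩ : ∃ Δ, Δ = x - p := ⟨_, rfl⟩
  have hxΔ : c • x = P + c • Δ := by rw [hΔ, hPp, smul_sub]; abel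
  rw [← hΔ] at hx
  rw [← sub_eq_zero]
  generalize c • (x * x) - x = z at hz hcomm hzz
  simp only [sandwich_apply] at hz
  have hz1 : P * (z * P) = 0 := by
    have := congrArg (P * ·) hz
    simpa only [mul_sub, hPP', ← mul_assoc P (1 - P), hPQ, zero_mul, sub_zero, mul_zero] using this
  have hz2 : (1 - P) * (z * (1 - P)) = 0 := by
    rw [hz1, zero_sub, neg_eq_zero] at hz
    exact hz
  have ha : P * (z * (1 - P)) = 0 := by
    apply hx
    rw [hB]
    -- Let `a = P z (1-P)` and `Q = 1 - P`. Since `x` commutes with `z` and the diagonal corners of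
    -- `z` vanish, comparing the `P`-`Q` corners of `x z` and `z x` gives `(P x P) a = a (Q x Q)`.
    -- Inserting `c x = P + c Δ` turns this into `a = B Δ a`, and small `Δ` forces `a = 0`.
    have h1 : P * (x * z) * (1 - P) = P * (x * P) * (P * (z * (1 - P))) := by
      have : P * (x * z) * (1 - P) = P * (x * P) * (P * (z * (1 - P))) +
          P * x * ((1 - P) * (z * (1 - P))) + P * x * (P * (z * (1-P)) - P * P * (z * (1 - P))) := by
        noncomm_ring
      rw [this, hz2, hPP, sub_self, mul_zero, add_zero, add_zero]
    have h2 : P * (z * x) * (1 - P) = P * (z * (1 - P)) * ((1 - P) * (x * (1 - P))) := by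
      have : P * (z * x) * (1 - P) = P * (z * ((1 - P) * (1 - P))) * (x * (1 - P)) +
          (P * (z * P)) * (x * (1 - P)) + P * z * ((1 - P) - (1 - P) * (1 - P)) * x * (1 - P) := by
        noncomm_ring
      rw [this, hz1, hQQ, sub_self]
      simp only [mul_zero, zero_mul, add_zero]
      conv_lhs => rw [← hQQ]
      simp only [mul_assoc]
      rw [hQQ]
    have h3 : (P * ((c • x) * P)) * (P * (z * (1 - P))) =
        P * (z * (1 - P)) * ((1 - P) * ((c • x) * (1 - P))) := by
      simp only [smul_mul_assoc, mul_smul_comm]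
      rw [← h1, ← h2, hcomm]
    rw [hxΔ] at h3
    have h4 : P * ((P + c • Δ) * P) * (P * (z * (1 - P))) =
        P * (z * (1 - P)) + c • (P * (Δ * P) * (P * (z * (1 - P)))) := by
      rw [add_mul, mul_add, add_mul, smul_mul_assoc, mul_smul_comm, smul_mul_assoc, hPP, hPP, hPP']
    have h5 : (1 - P) * ((P + c • Δ) * (1 - P)) = c • ((1 - P) * (Δ * (1 - P))) := by
      rw [add_mul, hPQ, zero_add, smul_mul_assoc, mul_smul_comm]
    rw [h4, h5, mul_smul_comm] at h3
    exact eq_sub_of_add_eq h3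
  have hb : (1 - P) * (z * P) = 0 := by
    have := congrArg Matrix.conjTranspose ha
    rwa [Matrix.conjTranspose_mul, Matrix.conjTranspose_mul, hzz, hP, conjTranspose_one_sub hP,
      Matrix.conjTranspose_zero, mul_assoc] at this
  have : z = P * (z * P) + P * (z * (1 - P)) + (1 - P) * (z * P) + (1 - P) * (z * (1 - P)) := by
    noncomm_ring
  rw [this, hz1, hz2, ha, hb]
  simp

theorem continuous_entry (i j : Fin k) : Continuous fun x : Matrix (Fin k) (Fin k) 𝕜 => x i j :=
  (Matrix.entryLinearMap ℝ 𝕜 i j).continuous_of_finiteDimensional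

theorem eventually_entry_ne_zero (p : Matrix (Fin k) (Fin k) 𝕜) :
    ∀ᶠ x in 𝓝 p, ∀ i j, p i j ≠ 0 → x i j ≠ 0 := by
  rw [eventually_all]
  intro i
  rw [eventually_all]
  intro j
  by_cases h : p i j = 0
  · exact Eventually.of_forall fun x h' => absurd h h'
  · filter_upwards [(continuous_entry i j).continuousAt.eventually_ne h] with x hx _ using hx

/-- Near a projection, block diagonal projections have the same block traces. -/
theorem eventually_sum_diag_eq {c : ℝ} (hc : c ≠ 0) {p : Matrix (Fin k) (Fin k) 𝕜}
    (hpp : c • (p * p) = p) :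
    ∀ᶠ x in 𝓝 p, c • (x * x) = x → ∀ A : Finset (Fin k), Inv p A → Inv x A →
      ∑ i ∈ A, x i i = ∑ i ∈ A, p i i := by
  have hcont : ∀ A : Finset (Fin k), ∀ᶠ x in 𝓝 p,
      ‖(c : 𝕜) * ∑ i ∈ A, x i i - (c : 𝕜) * ∑ i ∈ A, p i i‖ < 1 := by
    intro A
    have h1 : Continuous fun x : Matrix (Fin k) (Fin k) 𝕜 =>
        ‖(c : 𝕜) * ∑ i ∈ A, x i i - (c : 𝕜) * ∑ i ∈ A, p i i‖ :=
      ((continuous_const.mul (continuous_finsetSum _ fun i _ => continuous_entry i i)).sub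
        continuous_const).norm
    exact h1.continuousAt.eventually_lt continuousAt_const (by simp)
  have hcK : (c : 𝕜) ≠ 0 := RCLike.ofReal_ne_zero.2 hc
  -- The scaled block traces are ranks, hence natural numbers; two of them at distance less than `1`
  -- coincide.
  have hint : ∀ y : Matrix (Fin k) (Fin k) 𝕜, c • (y * y) = y → ∀ A, Inv y A →
      ∃ r : ℕ, (c : 𝕜) * ∑ i ∈ A, y i i = r := by
    intro y hy A hA
    have hy' : ((c : 𝕜) • y) * ((c : 𝕜) • y) = (c : 𝕜) • y := by
      conv_rhs => rw [← hy]
      rw [smul_mul_assoc, mul_smul_comm, RCLike.real_smul_eq_coe_smul (K := 𝕜) c]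
    obtain ⟨r, hr⟩ := exists_nat_sum_diag hy' ((inv_smul_iff hcK y A).2 hA)
    refine ⟨r, ?_⟩
    rw [← hr, Finset.mul_sum]
    rfl
  filter_upwards [eventually_all.2 hcont] with x hx hxx A hpA hxA
  obtain ⟨r, hr⟩ := hint x hxx A hxA
  obtain ⟨r', hr'⟩ := hint p hpp A hpA
  have h1 := hx A
  rw [hr, hr', ← Int.cast_natCast (R := 𝕜) r, ← Int.cast_natCast (R := 𝕜) r', ← Int.cast_sub,
    ← RCLike.ofReal_intCast, RCLike.norm_ofReal, ← Int.cast_abs] at h1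
  have h2 : |(r : ℤ) - r'| < 1 := by exact_mod_cast h1
  have h3 : r = r' := by
    rw [Int.abs_lt_one_iff] at h2
    omega
  exact mul_left_cancel₀ hcK (by rw [hr, hr', h3])

end

end TightFrame

/-! ### Strata as analytic submanifolds -/

namespace TightFrame

open Filter Topology

section
variable {𝕜 β : Type*} [RCLike 𝕜] {k n : ℕ} {b : Fin k → β}

/-- The set of all `R ∈ G_{k,n}` whose irreducible blocks are the fibres of `b`. -/
def blockStratum (𝕜 : Type*) [RCLike 𝕜] {k : ℕ} (n : ℕ) (b : Fin k → β) :
    Set (Matrix (Fin k) (Fin k) 𝕜) :=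
  {R | R ∈ G 𝕜 k n ∧ BlockConn b R}

theorem stratum_eq_blockStratum (σ : Finpartition (Finset.univ : Finset (Fin k))) :
    stratum 𝕜 k n ↑σ.parts = blockStratum 𝕜 n σ.part := by
  ext R
  exact and_congr_right fun _ => commPartition_eq_parts_iff R σ

theorem N_eq_blockStratum (hk : 0 < k) : N 𝕜 k n = blockStratum 𝕜 n (fun _ : Fin k => ()) := by
  ext R
  exact and_congr_right fun _ => commPartition_eq_univ_iff hk R

theorem mem_G_iff_real (hn : 0 < n) (hk : 0 < k) (R : Matrix (Fin k) (Fin k) 𝕜) :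
    R ∈ G 𝕜 k n ↔
      R.conjTranspose = R ∧ ((n : ℝ) / k) • (R * R) = R ∧ ∀ i, R i i = 1 := by
  have h : ((n : ℝ) / k) • (R * R) = ((n : 𝕜) / k) • (R * R) := by
    rw [RCLike.real_smul_eq_coe_smul (K := 𝕜)]
    norm_num
  rw [mem_G_iff hn hk, h]

theorem BlockConn.blockDiag {X : Matrix (Fin k) (Fin k) 𝕜} (h : BlockConn b X) :
    BlockDiag b X := fun i j hij => by_contra fun h' => hij (h.1 i j h')

theorem BlockConn.smul {X : Matrix (Fin k) (Fin k) 𝕜} (h : BlockConn b X) {c : ℝ} (hc : c ≠ 0) :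
    BlockConn b (c • X) := by
  refine ⟨fun i j hij => h.1 i j fun h0 => hij ?_, fun A hA => h.2 A fun i j hij => hA i j ?_⟩
  · rw [Matrix.smul_apply, h0, smul_zero]
  · rw [Matrix.smul_apply]
    exact smul_ne_zero hc hij

/-- Connectivity is an open condition among block diagonal matrices, since nonzero entries stay
nonzero; it therefore adds no equation. The set `s` holds the indices whose diagonal equation is
omitted, at most one per block. -/
theorem eventually_mem_blockStratum_iff (hn : 0 < n) (hk : 0 < k)
    {p : Matrix (Fin k) (Fin k) 𝕜} (hp : p ∈ blockStratum 𝕜 n b) {s : Fin k → Prop}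
    (hs : ∀ i j, s i → s j → b i = b j → i = j) :
    ∀ᶠ x in 𝓝 p, x ∈ blockStratum 𝕜 n b ↔
      ((projDeriv b (((n : ℝ) / k) • p)).prod (reDiag 𝕜 s)) (x - p) +
        (projQuad b (((n : ℝ) / k) • p) ((n : ℝ) / k)).compr₂ (LinearMap.inl ℝ _ _)
          (x - p) (x - p) = 0 := by
  classical
  obtain ⟨hpG, hpb⟩ := hp
  obtain ⟨hp1, hp2, hp3⟩ := (mem_G_iff_real hn hk p).1 hpG
  have hc : (n : ℝ) / k ≠ 0 := by positivity
  generalize hcdef : (n : ℝ) / k = c at *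
  obtain ⟨P, hP⟩ : ∃ P, P = c • p := ⟨_, rfl⟩
  have hPH : P.conjTranspose = P := by rw [hP, Matrix.conjTranspose_smul, hp1, star_trivial]
  have hPP : P * P = P := by rw [hP, smul_mul_assoc, mul_smul_comm, hp2]
  have hPb : BlockDiag b P := hP ▸ hpb.blockDiag.smul c
  have hpfix : hermBlock 𝕜 b p = p := hermBlock_eq_iff.2 ⟨hp1, hpb.blockDiag⟩
  rw [← hP]
  filter_upwards [eventually_isProj hPH hPP hP, eventually_entry_ne_zero p,
    eventually_sum_diag_eq hc hp2] with x hx1 hx2 hx3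
  have key : ((projDeriv b P).prod (reDiag 𝕜 s)) (x - p) +
        (projQuad b P c).compr₂ (LinearMap.inl ℝ _ _) (x - p) (x - p) =
      (x - hermBlock 𝕜 b x +
      (sandwich P (c • (hermBlock 𝕜 b x * hermBlock 𝕜 b x) - hermBlock 𝕜 b x) -
        sandwich (1 - P) (c • (hermBlock 𝕜 b x * hermBlock 𝕜 b x) - hermBlock 𝕜 b x)),
        reDiag 𝕜 s (x - p)) := by
    rw [← projDeriv_add_projQuad hpfix hp2 hP x]
    simp [LinearMap.compr₂_apply]
  rw [key, Prod.mk_eq_zero]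
  constructor
  · rintro ⟨hxG, hxb⟩
    obtain ⟨h1, h2, h3⟩ := (mem_G_iff_real hn hk x).1 hxG
    rw [hcdef] at h2
    have hfix : hermBlock 𝕜 b x = x := hermBlock_eq_iff.2 ⟨h1, hxb.blockDiag⟩
    rw [hfix, h2, sub_self, map_zero, map_zero, sub_self, add_zero]
    refine ⟨by simp, ?_⟩
    ext i
    rw [reDiag_apply, Matrix.sub_apply, h3, hp3, sub_self, map_zero, Pi.zero_apply]
  · rintro ⟨h1, h2⟩
    have hyfix := hermBlock_hermBlock (b := b) x
    have hwfix : hermBlock 𝕜 b (c • (hermBlock 𝕜 b x * hermBlock 𝕜 b x) - hermBlock 𝕜 b x) =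
        c • (hermBlock 𝕜 b x * hermBlock 𝕜 b x) - hermBlock 𝕜 b x := by
      refine hermBlock_eq_iff.2 ⟨?_, (((blockDiag_hermBlock x).mul
        (blockDiag_hermBlock x)).smul c).sub (blockDiag_hermBlock x)⟩
      rw [Matrix.conjTranspose_sub, Matrix.conjTranspose_smul, Matrix.conjTranspose_mul,
        conjTranspose_hermBlock, star_trivial]
    -- `hermBlock` kills `x - hermBlock x` and fixes the corner terms, so the single equation splits
    -- into `x = hermBlock x` and the corner equation.
    have h3 := congrArg (hermBlock 𝕜 b) h1
    rw [map_add, map_sub, map_sub, hyfix, sub_self, zero_add, map_zero,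
      hermBlock_sandwich hPH hPb hwfix,
      hermBlock_sandwich (conjTranspose_one_sub hPH) (blockDiag_one.sub hPb) hwfix] at h3
    rw [h3, add_zero, sub_eq_zero] at h1
    rw [← h1] at h3
    obtain ⟨hxH, hxb⟩ := hermBlock_eq_iff.1 h1.symm
    have hxx := hx1 hxH h3
    have hconn : BlockConn b x := by
      refine ⟨fun i j hij => by_contra fun h => hij (hxb i j h), fun A hA => hpb.2 A ?_⟩
      exact fun i j hij => hA i j (hx2 i j hij)
    have hdiag : ∀ i, ¬ s i → x i i = 1 := by
      intro i hi
      have h4 := congrFun h2 ⟨i, hi⟩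
      rw [reDiag_apply, Matrix.sub_apply, hp3, map_sub, Pi.zero_apply, RCLike.one_re,
        sub_eq_zero] at h4
      have h5 : star (x i i) = x i i := by
        conv_rhs => rw [← hxH]
        rfl
      rw [RCLike.star_def] at h5
      rw [← RCLike.conj_eq_iff_re.1 h5, h4, RCLike.ofReal_one]
    refine ⟨(mem_G_iff_real hn hk x).2 ⟨hxH, by rw [hcdef, hxx], fun i => ?_⟩, hconn⟩
    by_cases hi : s i
    -- The omitted entry is recovered from the block trace, which agrees with that of `p`, as all
    -- other diagonal entries of the block are `1`.
    · have hInv : ∀ y : Matrix (Fin k) (Fin k) 𝕜, BlockDiag b y →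
          Inv y (Finset.univ.filter fun j => b j = b i) := fun y hy l m hlm => by
        have : b l = b m := by_contra fun h => hlm (hy l m h)
        simp [this]
      have h4 := hx3 hxx _ (hInv p hpb.blockDiag) (hInv x hxb)
      rw [← Finset.add_sum_erase _ _ (a := i) (by simp),
        ← Finset.add_sum_erase _ (fun i => p i i) (a := i) (by simp), hp3] at h4
      refine add_right_cancel (h4.trans (congrArg _ (Finset.sum_congr rfl fun j hj => ?_)))
      rw [Finset.mem_erase, Finset.mem_filter] at hj
      rw [hp3, hdiag j fun hjs => hj.1 (hs j i hjs hi hj.2.2)]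
    · exact hdiag i hi

-- Here `s` picks exactly one representative per block. The number `u` is the rank of the corner
-- projection, whose integrality comes from a point of the stratum; quantifying over `u` in `hd`
-- spares the caller from proving it.
open Classical in
theorem isAnalyticSubmanifold_blockStratum (hn : 0 < n) (hk : 0 < k) {s : Fin k → Prop}
    (hs : ∀ i, ∃ j, b j = b i ∧ s j) (hs' : ∀ i j, s i → s j → b i = b j → i = j) (d : ℕ)
    (hd : ∀ u : ℕ, (u : ℝ) = ((Finset.univ.filter fun q : Fin k × Fin k => b q.1 = b q.2).card : ℝ)
      * ((n : ℝ) / k * (1 - (n : ℝ) / k)) →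
      d = Module.finrank ℝ 𝕜 * u - Nat.card {i // ¬ s i}) :
    IsAnalyticSubmanifold (blockStratum 𝕜 n b) d := by
  refine isAnalyticSubmanifold_of_quadratic (W := Matrix (Fin k) (Fin k) 𝕜 × ({i // ¬ s i} → ℝ))
    _ _ fun p hp => ?_
  have hloc := eventually_mem_blockStratum_iff hn hk hp hs'
  obtain ⟨hpG, hpb⟩ := hp
  obtain ⟨hp1, hp2, hp3⟩ := (mem_G_iff_real hn hk p).1 hpG
  have hc : (n : ℝ) / k ≠ 0 := by positivity
  generalize (n : ℝ) / k = c at *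
  obtain ⟨P, hP⟩ : ∃ P, P = c • p := ⟨_, rfl⟩
  have hPH : P.conjTranspose = P := by rw [hP, Matrix.conjTranspose_smul, hp1, star_trivial]
  have hPP : P * P = P := by rw [hP, smul_mul_assoc, mul_smul_comm, hp2]
  have hPconn : BlockConn b P := hP ▸ hpb.smul hc
  rw [← hP] at hloc
  have hsurj := fun v => exists_tangent_reDiag_eq hPH hPP hPconn hs v
  refine ⟨_, _, fun X => ?_, hloc, ?_⟩
  -- The quadratic term is `(q, 0)` and the derivative sends `q` to `(q, reDiag q)`. Adding a
  -- tangent vector `t` with `reDiag t = -reDiag q` corrects the second component without changing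
  -- the first.
  · obtain ⟨t, ht, htv⟩ := hsurj (-reDiag 𝕜 s (projQuad b P c X X))
    refine ⟨projQuad b P c X X + t, ?_⟩
    rw [map_add, LinearMap.prod_apply, LinearMap.prod_apply]
    simp only [Function.prod_apply, LinearMap.compr₂_apply, LinearMap.inl_apply]
    rw [projQuad_mem_range hPH hPP hPconn.blockDiag, LinearMap.mem_ker.1 ht, htv]
    simp
  · have h1 := finrank_ker_prod_add (projDeriv b P) (reDiag 𝕜 s) hsurj
    rw [finrank_ker_projDeriv hPH hPP hPconn.blockDiag, Module.finrank_fintype_fun_eq_card,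
      ← Nat.card_eq_fintype_card] at h1
    have h2 := finrank_range_offProj hPP hPconn.blockDiag (c := (c : 𝕜)) fun i => by
      rw [hP, Matrix.smul_apply, hp3, RCLike.real_smul_eq_coe_mul, mul_one]
    rw [hd _ (by exact_mod_cast h2), ← h1, Nat.add_sub_cancel]

theorem isAnalyticSubmanifold_N (hn : 0 < n) (hkn : n < k) :
    IsAnalyticSubmanifold (N 𝕜 k n)
      (if Module.finrank ℝ 𝕜 = 1 then (k - n - 1) * (n - 1) else 2 * n * (k - n) - k + 1) := by
  have hk : 0 < k := hn.trans hkn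
  rw [N_eq_blockStratum hk]
  refine isAnalyticSubmanifold_blockStratum hn hk (s := fun i => i = ⟨0, hk⟩)
    (fun _ => ⟨⟨0, hk⟩, rfl, rfl⟩) (fun i j hi hj _ => hi.trans hj.symm) _ fun u hu => ?_
  have hk' : (k : ℝ) ≠ 0 := by exact_mod_cast hk.ne'
  obtain ⟨m, rfl⟩ := Nat.exists_eq_add_of_lt hkn
  have hu' : u = n * (m + 1) := by
    simp only [Finset.filter_true, Finset.card_univ, Fintype.card_prod, Fintype.card_fin] at hu
    have : (u : ℝ) = n * (m + 1) := by
      rw [hu]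
      push_cast at hk' ⊢
      field_simp
      ring
    exact_mod_cast this
  have hcard : Nat.card {i : Fin (n + m + 1) // ¬ i = ⟨0, hk⟩} = n + m := by
    rw [Nat.card_eq_fintype_card, Fintype.card_subtype_compl, Fintype.card_subtype_eq, Fintype.card_fin]
    omega
  rw [hu', hcard]
  obtain ⟨l, rfl⟩ := Nat.exists_eq_add_of_lt hn
  have h2 : Module.finrank ℝ 𝕜 ≤ 2 := RCLike.finrank_le_two 𝕜
  have h1 : 0 < Module.finrank ℝ 𝕜 := Module.finrank_pos
  split_ifs with h
  · rw [h, Nat.zero_add, Nat.add_sub_cancel,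
      show l + 1 + m + 1 - (l + 1) - 1 = m by omega, one_mul]
    refine (Nat.sub_eq_of_eq_add ?_).symm
    ring
  · rw [show Module.finrank ℝ 𝕜 = 2 by omega, Nat.zero_add,
      show l + 1 + m + 1 - (l + 1) = m + 1 by omega]
    -- This is `k ≤ 2n(k-n)`, which makes the truncated subtraction in the dimension formula exact.
    have : l + 1 + m + 1 ≤ 2 * (l + 1) * (m + 1) := by nlinarith
    rw [mul_assoc] at this ⊢
    omega

theorem exists_isAnalyticSubmanifold_blockStratum (hn : 0 < n) (hk : 0 < k) {s : Fin k → Prop}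
    (hs : ∀ i, ∃ j, b j = b i ∧ s j) (hs' : ∀ i j, s i → s j → b i = b j → i = j) :
    ∃ e : ℕ, IsAnalyticSubmanifold (blockStratum 𝕜 n b) e := by
  classical
  refine ⟨Module.finrank ℝ 𝕜 *
    ⌊((Finset.univ.filter fun q : Fin k × Fin k => b q.1 = b q.2).card : ℝ)
      * ((n : ℝ) / k * (1 - (n : ℝ) / k))⌋₊ - Nat.card {i // ¬ s i},
    isAnalyticSubmanifold_blockStratum hn hk hs hs' _ fun u hu => ?_⟩
  rw [← hu, Nat.floor_natCast]

theorem exists_isAnalyticSubmanifold_stratum (hn : 0 < n) (hk : 0 < k)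
    (σ : Finpartition (Finset.univ : Finset (Fin k))) :
    ∃ e : ℕ, IsAnalyticSubmanifold (stratum 𝕜 k n ↑σ.parts) e := by
  rw [stratum_eq_blockStratum]
  -- The representative of each block is its least element.
  refine exists_isAnalyticSubmanifold_blockStratum hn hk (s := fun i => ∀ j ∈ σ.part i, i ≤ j)
    (fun i => ?_) (fun i j hi hj hij => ?_)
  · have hne : (σ.part i).Nonempty := by simp
    have hmem := Finset.min'_mem _ hne
    have heq : σ.part ((σ.part i).min' hne) = σ.part i :=
      (σ.mem_part_iff_part_eq_part (Finset.mem_univ _) (Finset.mem_univ _)).1 hmem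
    refine ⟨_, heq, fun j hj => Finset.min'_le _ _ ?_⟩
    rwa [heq] at hj
  · exact le_antisymm (hi j (by rw [hij]; simp)) (hj i (by rw [← hij]; simp))

end

end TightFrame

/-! ### Splitting a stratum into a product over its blocks -/

namespace TightFrame

theorem BlockConn.congr {𝕜 β γ : Type*} [Zero 𝕜] {k : ℕ} {b : Fin k → β} {b' : Fin k → γ}
    (h : ∀ i j, b i = b j ↔ b' i = b' j) {T : Matrix (Fin k) (Fin k) 𝕜} (hT : BlockConn b T) :
    BlockConn b' T :=
  ⟨fun i j hij => (h i j).1 (hT.1 i j hij), fun A hA i j hij => hT.2 A hA i j ((h i j).2 hij)⟩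

theorem blockStratum_congr {𝕜 β γ : Type*} [RCLike 𝕜] {k : ℕ} (n : ℕ) {b : Fin k → β}
    {b' : Fin k → γ} (h : ∀ i j, b i = b j ↔ b' i = b' j) :
    blockStratum 𝕜 n b = blockStratum 𝕜 n b' := by
  ext R
  exact and_congr_right fun _ => ⟨BlockConn.congr h, BlockConn.congr fun i j => (h i j).symm⟩

section
variable {𝕜 ι : Type*} [RCLike 𝕜] [DecidableEq ι] {k n : ℕ} {q r : ι → ℕ}

/-- Assembling a block diagonal matrix from its diagonal blocks. -/
def assemble (𝕜 : Type*) [RCLike 𝕜] (E : Fin k ≃ Σ A, Fin (q A)) :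
    ((A : ι) → Matrix (Fin (q A)) (Fin (q A)) 𝕜) →ₗ[ℝ] Matrix (Fin k) (Fin k) 𝕜 where
  toFun x := (Matrix.blockDiagonal' x).submatrix E E
  map_add' x y := by rw [Matrix.blockDiagonal'_add]; rfl
  map_smul' a x := by rw [Matrix.blockDiagonal'_smul]; rfl

/-- The diagonal blocks of a matrix. -/
def diagBlocks (𝕜 : Type*) [RCLike 𝕜] (E : Fin k ≃ Σ A, Fin (q A)) :
    Matrix (Fin k) (Fin k) 𝕜 →ₗ[ℝ] ((A : ι) → Matrix (Fin (q A)) (Fin (q A)) 𝕜) where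
  toFun X := Matrix.blockDiag' (X.submatrix E.symm E.symm)
  map_add' _ _ := rfl
  map_smul' _ _ := rfl

theorem assemble_apply (E : Fin k ≃ Σ A, Fin (q A))
    (x : (A : ι) → Matrix (Fin (q A)) (Fin (q A)) 𝕜) :
    assemble 𝕜 E x = (Matrix.blockDiagonal' x).submatrix E E := rfl

theorem diagBlocks_assemble (E : Fin k ≃ Σ A, Fin (q A))
    (x : (A : ι) → Matrix (Fin (q A)) (Fin (q A)) 𝕜) : diagBlocks 𝕜 E (assemble 𝕜 E x) = x := by
  change Matrix.blockDiag' (((Matrix.blockDiagonal' x).submatrix E E).submatrix E.symm E.symm) = x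
  rw [Matrix.submatrix_submatrix, Equiv.self_comp_symm, Matrix.submatrix_id_id,
    Matrix.blockDiag'_blockDiagonal']

theorem assemble_injective (E : Fin k ≃ Σ A, Fin (q A)) : Function.Injective (assemble 𝕜 E) :=
  Function.LeftInverse.injective (diagBlocks_assemble E)

theorem assemble_same (E : Fin k ≃ Σ A, Fin (q A))
    (x : (A : ι) → Matrix (Fin (q A)) (Fin (q A)) 𝕜) (A : ι) (s t : Fin (q A)) :
    assemble 𝕜 E x (E.symm ⟨A, s⟩) (E.symm ⟨A, t⟩) = x A s t := by
  rw [assemble_apply, Matrix.submatrix_apply, E.apply_symm_apply, E.apply_symm_apply,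
    Matrix.blockDiagonal'_apply_eq]

theorem blockDiag_assemble (E : Fin k ≃ Σ A, Fin (q A))
    (x : (A : ι) → Matrix (Fin (q A)) (Fin (q A)) 𝕜) :
    BlockDiag (fun i => (E i).1) (assemble 𝕜 E x) := fun i j hij => by
  rw [assemble_apply, Matrix.submatrix_apply]
  exact Matrix.blockDiagonal'_apply_ne x (E i).2 (E j).2 hij

theorem BlockDiag.assemble_diagBlocks (E : Fin k ≃ Σ A, Fin (q A))
    {X : Matrix (Fin k) (Fin k) 𝕜} (hX : BlockDiag (fun i => (E i).1) X) :
    assemble 𝕜 E (diagBlocks 𝕜 E X) = X := by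
  ext i j
  by_cases hij : (E i).1 = (E j).1
  · obtain ⟨⟨A, s⟩, rfl⟩ := E.symm.surjective i
    obtain ⟨⟨A', t⟩, rfl⟩ := E.symm.surjective j
    simp only [Equiv.apply_symm_apply] at hij
    subst hij
    rw [assemble_same]
    rfl
  · rw [blockDiag_assemble E _ i j hij, hX i j hij]

theorem blockConn_assemble_iff (E : Fin k ≃ Σ A, Fin (q A))
    (x : (A : ι) → Matrix (Fin (q A)) (Fin (q A)) 𝕜) :
    BlockConn (fun i => (E i).1) (assemble 𝕜 E x) ↔ ∀ A, BlockConn (fun _ => ()) (x A) := by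
  constructor
  · rintro ⟨-, h⟩ A
    refine ⟨fun _ _ _ => rfl, fun C hC s t _ hs => ?_⟩
    have hinv : Inv (assemble 𝕜 E x)
        (Finset.univ.filter fun i => ∃ c ∈ C, E i = ⟨A, c⟩) := by
      intro i j hij
      have hb : (E i).1 = (E j).1 := by_contra fun h' => hij (blockDiag_assemble E x i j h')
      obtain ⟨⟨A', s'⟩, rfl⟩ := E.symm.surjective i
      obtain ⟨⟨A'', t'⟩, rfl⟩ := E.symm.surjective j
      simp only [Equiv.apply_symm_apply] at hb
      subst hb
      rw [assemble_same] at hij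
      simp only [Finset.mem_filter, Finset.mem_univ, true_and, Equiv.apply_symm_apply]
      by_cases hA : A' = A
      · subst hA
        simpa using hC s' t' hij
      · simp [Sigma.ext_iff, hA]
    have := h _ hinv (E.symm ⟨A, s⟩) (E.symm ⟨A, t⟩) (by simp) (by simpa using hs)
    simpa using this
  · intro h
    refine ⟨fun i j hij => by_contra fun h' => hij (blockDiag_assemble E x i j h'),
      fun B hB i j hb hi => ?_⟩
    obtain ⟨⟨A, s⟩, rfl⟩ := E.symm.surjective i
    obtain ⟨⟨A', t⟩, rfl⟩ := E.symm.surjective j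
    simp only [Equiv.apply_symm_apply] at hb
    subst hb
    have hinv : Inv (x A) (Finset.univ.filter fun c => E.symm ⟨A, c⟩ ∈ B) := by
      intro s t hst
      simpa using hB (E.symm ⟨A, s⟩) (E.symm ⟨A, t⟩) (by rwa [assemble_same])
    have := (h A).2 _ hinv s t rfl (by simpa using hi)
    simpa using this

/-- Adjoint, product, diagonal and connectivity are all computed block by block. The scaling factor
in the projection equation is the same in every block by `hratio`, so no coupling between blocks
remains. -/
theorem assemble_mem_blockStratum_iff [Fintype ι] (hn : 0 < n) (hk : 0 < k) (hr : ∀ A, 0 < r A)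
    (hq : ∀ A, 0 < q A) (hratio : ∀ A, (r A : ℝ) / q A = n / k) (E : Fin k ≃ Σ A, Fin (q A))
    (x : (A : ι) → Matrix (Fin (q A)) (Fin (q A)) 𝕜) :
    assemble 𝕜 E x ∈ blockStratum 𝕜 n (fun i => (E i).1) ↔
      ∀ A, x A ∈ blockStratum 𝕜 (r A) (fun _ => ()) := by
  have h1 : (assemble 𝕜 E x).conjTranspose = assemble 𝕜 E x ↔
      ∀ A, (x A).conjTranspose = x A := by
    rw [assemble_apply, Matrix.conjTranspose_submatrix, Matrix.blockDiagonal'_conjTranspose,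
      ← assemble_apply, ← assemble_apply, (assemble_injective E).eq_iff, funext_iff]
  have h2 : ((n : ℝ) / k) • (assemble 𝕜 E x * assemble 𝕜 E x) = assemble 𝕜 E x ↔
      ∀ A, ((r A : ℝ) / q A) • (x A * x A) = x A := by
    rw [assemble_apply, Matrix.submatrix_mul_equiv, ← Matrix.blockDiagonal'_mul, ← assemble_apply,
      ← assemble_apply, ← map_smul, (assemble_injective E).eq_iff, funext_iff]
    exact forall_congr' fun A => by rw [hratio]; rfl
  have h3 : (∀ i, assemble 𝕜 E x i i = 1) ↔ ∀ A s, x A s s = 1 := by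
    rw [← E.symm.forall_congr_right (q := fun i => assemble 𝕜 E x i i = 1), Sigma.forall]
    simp only [assemble_same]
  have hmem : ∀ A, x A ∈ blockStratum 𝕜 (r A) (fun _ => ()) ↔ ((x A).conjTranspose = x A ∧
      ((r A : ℝ) / q A) • (x A * x A) = x A ∧ ∀ s, x A s s = 1) ∧ BlockConn (fun _ => ()) (x A) :=
    fun A => and_congr_left fun _ => mem_G_iff_real (hr A) (hq A) (x A)
  simp only [hmem, forall_and]
  rw [← blockConn_assemble_iff E, ← h1, ← h2, ← h3, ← mem_G_iff_real hn hk]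
  rfl

theorem analyticallyDiffeomorphic_blockStratum [Fintype ι] (hn : 0 < n) (hk : 0 < k) (hr : ∀ A, 0 < r A)
    (hq : ∀ A, 0 < q A) (hratio : ∀ A, (r A : ℝ) / q A = n / k) (E : Fin k ≃ Σ A, Fin (q A)) :
    AnalyticallyDiffeomorphic (blockStratum 𝕜 n (fun i => (E i).1))
      {x : (A : ι) → Matrix (Fin (q A)) (Fin (q A)) 𝕜 |
        ∀ A, x A ∈ blockStratum 𝕜 (r A) (fun _ => ())} := by
  have hinv : ∀ X ∈ blockStratum 𝕜 n (fun i => (E i).1),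
      assemble 𝕜 E (diagBlocks 𝕜 E X) = X := fun X hX =>
    BlockDiag.assemble_diagBlocks E hX.2.blockDiag
  refine ⟨diagBlocks 𝕜 E, assemble 𝕜 E, fun X hX => ?_,
    fun x hx => (assemble_mem_blockStratum_iff hn hk hr hq hratio E x).2 hx,
    ⟨hinv, fun x _ => diagBlocks_assemble E x⟩,
    (diagBlocks 𝕜 E).toContinuousLinearMap.analyticOn _,
    (assemble 𝕜 E).toContinuousLinearMap.analyticOn _⟩
  refine (assemble_mem_blockStratum_iff hn hk hr hq hratio E _).1 ?_
  rwa [hinv X hX]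

end

/-- A partition into blocks of sizes `q A` identifies the index set with a disjoint union. -/
theorem exists_equiv_sigma {k : ℕ} (σ : Finpartition (Finset.univ : Finset (Fin k)))
    (q : σ.parts → ℕ) (hq : ∀ A : σ.parts, (A : Finset (Fin k)).card = q A) :
    ∃ E : Fin k ≃ Σ A : σ.parts, Fin (q A),
      ∀ i j, σ.part i = σ.part j ↔ (E i).1 = (E j).1 := by
  let e : Fin k ≃ (Finset.univ : Finset (Fin k)) :=
    (Equiv.subtypeUnivEquiv fun i => Finset.mem_univ i).symm
  refine ⟨(e.trans σ.equivSigmaParts).trans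
    (Equiv.sigmaCongrRight fun A => Finset.equivFinOfCardEq (hq A)), fun i j => ?_⟩
  exact (Subtype.ext_iff (a1 := (σ.equivSigmaParts (e i)).1)
    (a2 := (σ.equivSigmaParts (e j)).1)).symm

theorem stratum_diffeo {𝕜 : Type*} [RCLike 𝕜] {k n : ℕ} (hn : 0 < n) (hkn : n < k) (k' n' : ℕ)
    (hn' : 0 < n') (hkn' : n' < k') (hratio : (n' : ℝ) / k' = n / k)
    (σ : Finpartition (Finset.univ : Finset (Fin k))) (m : σ.parts → ℕ)
    (hm : ∀ A : σ.parts, (A : Finset (Fin k)).card = m A * k') :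
    (stratum 𝕜 k n ↑σ.parts).Nonempty ∧
      AnalyticallyDiffeomorphic (stratum 𝕜 k n ↑σ.parts)
        {x : (A : σ.parts) → Matrix (Fin (m A * k')) (Fin (m A * k')) 𝕜 |
          ∀ A, x A ∈ N 𝕜 (m A * k') (m A * n')} := by
  have hk : 0 < k := hn.trans hkn
  have hm0 : ∀ A, 0 < m A := fun A => by
    have h1 := Finset.card_pos.2 (σ.nonempty_of_mem_parts A.2)
    rw [hm] at h1
    exact Nat.pos_of_mul_pos_right h1
  have hq : ∀ A, 0 < m A * k' := fun A => Nat.mul_pos (hm0 A) (hn'.trans hkn')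
  have hr : ∀ A, 0 < m A * n' := fun A => Nat.mul_pos (hm0 A) hn'
  have hrat : ∀ A, ((m A * n' : ℕ) : ℝ) / (m A * k' : ℕ) = n / k := fun A => by
    have : (m A : ℝ) ≠ 0 := by exact_mod_cast (hm0 A).ne'
    rw [← hratio, Nat.cast_mul, Nat.cast_mul, mul_div_mul_left _ _ this]
  obtain ⟨E, hE⟩ := exists_equiv_sigma σ (fun A => m A * k') hm
  rw [stratum_eq_blockStratum, blockStratum_congr n hE]
  have hN : {x : (A : σ.parts) → Matrix (Fin (m A * k')) (Fin (m A * k')) 𝕜 |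
      ∀ A, x A ∈ N 𝕜 (m A * k') (m A * n')} =
      {x | ∀ A, x A ∈ blockStratum 𝕜 (m A * n') (fun _ => ())} := by
    ext x
    exact forall_congr' fun A => by rw [N_eq_blockStratum (hq A)]
  rw [hN]
  refine ⟨?_, analyticallyDiffeomorphic_blockStratum hn hk hr hq hrat E⟩
  -- Harmonic projections in the individual blocks, assembled, give a point of the stratum.
  have hne : ∀ A, (N 𝕜 (m A * k') (m A * n')).Nonempty := fun A =>
    N_nonempty 𝕜 (hr A) (Nat.mul_lt_mul_of_pos_left hkn' (hm0 A))
  choose x hx using hne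
  exact ⟨_, (assemble_mem_blockStratum_iff hn hk hr hq hrat E x).2 fun A => by
    rw [← N_eq_blockStratum (hq A)]; exact hx A⟩

end TightFrame

theorem mainTheorem2 {𝕜 : Type*} [RCLike 𝕜] (k n : ℕ) (hn : 0 < n) (hkn : n < k)
    (d k' n' : ℕ) (hd : d = Nat.gcd k n) (hk' : k' = k / d) (hn' : n' = n / d) :
    ((TightFrame.N 𝕜 k n).Nonempty ∧
      TightFrame.IsAnalyticSubmanifold (TightFrame.N 𝕜 k n)
        (if Module.finrank ℝ 𝕜 = 1 then (k - n - 1) * (n - 1) else 2 * n * (k - n) - k + 1)) ∧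
    (TightFrame.G 𝕜 k n =
        (⋃ σ ∈ TightFrame.partitionsByMultiples k k', TightFrame.stratum 𝕜 k n ↑σ.parts) ∧
      (TightFrame.partitionsByMultiples k k').PairwiseDisjoint
        (fun σ => TightFrame.stratum 𝕜 k n ↑σ.parts)) ∧
    (∀ σ ∈ TightFrame.partitionsByMultiples k k', ∀ m : σ.parts → ℕ,
      (∀ A : σ.parts, (A : Finset (Fin k)).card = m A * k') →
        (TightFrame.stratum 𝕜 k n ↑σ.parts).Nonempty ∧
        (∃ e : ℕ, TightFrame.IsAnalyticSubmanifold (TightFrame.stratum 𝕜 k n ↑σ.parts) e) ∧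
        TightFrame.AnalyticallyDiffeomorphic (TightFrame.stratum 𝕜 k n ↑σ.parts)
          {x : (A : σ.parts) → Matrix (Fin (m A * k')) (Fin (m A * k')) 𝕜 |
            ∀ A, x A ∈ TightFrame.N 𝕜 (m A * k') (m A * n')}) := by
  have hk : 0 < k := hn.trans hkn
  have hd0 : 0 < d := hd ▸ Nat.gcd_pos_of_pos_left n hk
  have hk'd : k' * d = k := hk' ▸ Nat.div_mul_cancel (hd ▸ Nat.gcd_dvd_left k n)
  have hn'd : n' * d = n := hn' ▸ Nat.div_mul_cancel (hd ▸ Nat.gcd_dvd_right k n)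
  have hn'0 : 0 < n' := Nat.pos_of_mul_pos_right (hn'd.symm ▸ hn)
  have hkn' : n' < k' := Nat.lt_of_mul_lt_mul_right (hn'd.symm ▸ hk'd.symm ▸ hkn)
  have hratio : (n' : ℝ) / k' = n / k := by
    have : (d : ℝ) ≠ 0 := by exact_mod_cast hd0.ne'
    rw [← hk'd, ← hn'd, Nat.cast_mul, Nat.cast_mul, mul_div_mul_right _ _ this]
  refine ⟨⟨TightFrame.N_nonempty 𝕜 hn hkn, TightFrame.isAnalyticSubmanifold_N hn hkn⟩,
    ⟨?_, TightFrame.pairwiseDisjoint_stratum 𝕜 k n _⟩, fun σ _ m hm => ?_⟩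
  · rw [hk', hd]
    exact TightFrame.G_eq_iUnion_stratum hn hk
  · obtain ⟨h1, h2⟩ := TightFrame.stratum_diffeo (𝕜 := 𝕜) hn hkn k' n' hn'0 hkn' hratio σ m hm
    exact ⟨h1, TightFrame.exists_isAnalyticSubmanifold_stratum hn hk σ, h2⟩
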